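/- Let $\mathbb T\subset\mathbb R$ be a closed bounded set with $a=\min\mathbb T<b=\max\mathbb T$. Put $\sigma(t)=\inf\{s\in\mathbb T: s>t\}$ and $\rho(t)=\sup\{s\in\mathbb T: s<t\}$ (with $\inf\emptyset=b$, $\sup\emptyset=a$), and $[a,b]_{\mathbb T}^\kappa=\mathbb T\setminus(\rho(b),b]$. A point $t\in\mathbb T$ is right-dense if $\sigma(t)=t$. A function $f$ on $\mathbb T$ has delta derivative $f^\Delta(t)$ at $t\in[a,b]_{\mathbb T}^\kappa$ if for every $\varepsilon>0$ there is a neighbourhood $U$ of $t$ in $\mathbb T$ with $|f(\sigma(t))-f(s)-f^\Delta(t)(\sigma(t)-s)|\le\varepsilon|\sigma(t)-s|$ for all $s\in U$. A function on $[a,b]_{\mathbb T}^\kappa$ is piecewise rd-continuous if it has finite one-sided limits at every point that can be approached from the respective side, and is continuous at all but finitely many right-dense points; such a function may be left undefined at finitely many right-dense points. Its delta integral is $\int_c^d f(t)\,\Delta t=F(d)-F(c)$, where $F$ is continuous on $\mathbb T$ and $F^\Delta=f$ on $[a,b]_{\mathbb T}^\kappa$ except possibly at finitely many right-dense points. A function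 $y$ is of class $C^1_{prd}$ if $y$ is continuous on $\mathbb T$ and $y^\Delta$ exists at all but finitely many points of $[a,b]_{\mathbb T}^\kappa$ and is piecewise rd-continuous. Put $\|y\|_{1,\infty}=\sup|y|+\sup|y^\Delta|$, with suprema over $[a,b]_{\mathbb T}^\kappa$ (the second over the points at which $y^\Delta$ exists). Let $y_a,y_b\in\mathbb R$ and call $y\in C^1_{prd}$ admissible if $y(a)=y_a$ and $y(b)=y_b$. Let $L=L(t,y,y^\Delta):[a,b]_{\mathbb T}^\kappa\times\mathbb R^2\to\mathbb R$ have partial derivatives $\partial L/\partial y$ and $\partial L/\partial y^\Delta$ that are continuous on $[a,b]_{\mathbb T}^\kappa\times\mathbb R^2$, and suppose that for every admissible $z$ the functions $L$, $\partial L/\partial y$ and $\partial L/\partial y^\Delta$, evaluated at $(t,z(t),z^\Delta(t))$, are piecewise rd-continuous in $t$. Let $y$ be a weak local minimizer of $$\mathcal L(y)=\int_a^b L(t,y(t),y^\Delta(t))\,\Delta t,\qquad y(a)=y_a,\quad y(b)=y_b,$$ that is, $y$ is admissible and there is $\delta>0$ with $\mathcal L(y)\le\mathcal L(z)$ for all admissible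 $z$ with $\|y-z\|_{1,\infty}<\delta$. Then there is a constant $c_1\in\mathbb R$ such that for all $t\in[a,b]_{\mathbb T}^\kappa$ $$\frac{\partial L}{\partial y^\Delta}\bigl(t,y(t),y^\Delta(t)\bigr)=\int_a^{\sigma(t)}\frac{\partial L}{\partial y}\bigl(\tau,y(\tau),y^\Delta(\tau)\bigr)\,\Delta\tau+c_1,$$ where at the (at most finitely many) points $t$ at which $y^\Delta(t)$ does not exist, the one-sided limits $y^\Delta(t-)$ and $y^\Delta(t+)$ exist and the equation holds with either of them in place of $y^\Delta(t)$ on the left-hand side. -/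

import Mathlib

open Set Filter Topology

noncomputable section

namespace TimeScale

/-- Forward jump operator of the time scale `T`, with `inf ∅ = sup T`. -/
def sigma (T : Set ℝ) (t : ℝ) : ℝ :=
  open Classical in if (T ∩ Ioi t).Nonempty then sInf (T ∩ Ioi t) else sSup T

/-- Backward jump operator of the time scale `T`, with `sup ∅ = inf T`. -/
def rho (T : Set ℝ) (t : ℝ) : ℝ :=
  open Classical in if (T ∩ Iio t).Nonempty then sSup (T ∩ Iio t) else sInf T

/-- `T^κ = T \ (ρ(b), b]`, where `b = max T`. -/
def kappa (T : Set ℝ) : Set ℝ :=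
  T \ Ioc (rho T (sSup T)) (sSup T)

/-- The number `f'` is a delta derivative at `t` of the function `f` on `T`. Only the values of
`f` on `T` matter. -/
def HasDeltaDerivAt (T : Set ℝ) (f : ℝ → ℝ) (f' t : ℝ) : Prop :=
  ∀ ε > 0, ∀ᶠ s in 𝓝[T] t, |f (sigma T t) - f s - f' * (sigma T t - s)| ≤ ε * |sigma T t - s|

/-- `f` is delta-differentiable at `t`. -/
def DeltaDifferentiableAt (T : Set ℝ) (f : ℝ → ℝ) (t : ℝ) : Prop :=
  ∃ f' : ℝ, HasDeltaDerivAt T f f' t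

/-- The delta derivative `f^Δ(t)`; the value is `0` where `f` is not delta-differentiable. -/
def deltaDeriv (T : Set ℝ) (f : ℝ → ℝ) (t : ℝ) : ℝ :=
  open Classical in if h : DeltaDifferentiableAt T f t then h.choose else 0

/-- One-sided limits of a function on `T^κ` exist (and are finite) wherever they make sense: at
`t` isolated from the right (left) in `T^κ` the right (left) filter below is trivial. -/
def IsRegulated (T : Set ℝ) (f : ℝ → ℝ) : Prop :=
  ∀ t ∈ T, (∃ l, Tendsto f (𝓝[kappa T ∩ Ioi t] t) (𝓝 l)) ∧
    (∃ l, Tendsto f (𝓝[kappa T ∩ Iio t] t) (𝓝 l))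

/-- Piecewise rd-continuous functions on `T^κ`: regulated, and continuous at all but finitely many
right-dense points. -/
def IsPiecewiseRdContinuous (T : Set ℝ) (f : ℝ → ℝ) : Prop :=
  IsRegulated T f ∧
    ∃ E : Set ℝ, E.Finite ∧
      ∀ t ∈ kappa T \ E, sigma T t = t → ContinuousWithinAt f (kappa T) t

/-- The class `C^1_prd`: `y` is continuous on `T`, and `y^Δ` exists at all but finitely many points
of `T^κ` and is piecewise rd-continuous. (The values of `deltaDeriv T y` at the finitely many
exceptional points, which are right-dense, do not influence piecewise rd-continuity.) -/
def IsC1prd (T : Set ℝ) (y : ℝ → ℝ) : Prop :=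
  ContinuousOn y T ∧
    (∃ E : Set ℝ, E.Finite ∧ ∀ t ∈ kappa T \ E, DeltaDifferentiableAt T y t) ∧
    IsPiecewiseRdContinuous T (deltaDeriv T y)

/-- `F` is an antiderivative on `T` of the piecewise rd-continuous function `f`: `F` is continuous
and `F^Δ = f` on `T^κ`, except possibly at finitely many right-dense points. -/
def IsDeltaAntideriv (T : Set ℝ) (f F : ℝ → ℝ) : Prop :=
  ContinuousOn F T ∧
    ∃ E : Set ℝ, E.Finite ∧ (∀ t ∈ E, sigma T t = t) ∧
      ∀ t ∈ kappa T \ E, HasDeltaDerivAt T F (f t) t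

/-- The delta integral `∫_c^d f(t) Δt = F(d) - F(c)`, with `F` an antiderivative of `f`
(`0` if there is none). -/
def deltaIntegral (T : Set ℝ) (f : ℝ → ℝ) (c d : ℝ) : ℝ :=
  open Classical in
    if h : ∃ F : ℝ → ℝ, IsDeltaAntideriv T f F then h.choose d - h.choose c else 0

/-- `sup_{t ∈ T^κ} |f(t)|`, possibly infinite. -/
def supNorm (T : Set ℝ) (f : ℝ → ℝ) : ENNReal :=
  ⨆ t ∈ kappa T, ‖f t‖ₑ

/-- `‖y‖_{1,∞} = ‖y‖_∞ + ‖y^Δ‖_∞`; points at which `y^Δ` does not exist do not contribute to the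
second supremum. -/
def norm1 (T : Set ℝ) (y : ℝ → ℝ) : ENNReal :=
  supNorm T y + supNorm T (deltaDeriv T y)

/-- The partial derivative `∂L/∂y (t, u, v)` of `L(t, y, y^Δ)`. -/
def dLdy (L : ℝ → ℝ → ℝ → ℝ) (t u v : ℝ) : ℝ := deriv (fun x => L t x v) u

/-- The partial derivative `∂L/∂y^Δ (t, u, v)` of `L(t, y, y^Δ)`. -/
def dLdv (L : ℝ → ℝ → ℝ → ℝ) (t u v : ℝ) : ℝ := deriv (fun x => L t u x) v

/-- `y ∈ C^1_prd` with the prescribed boundary values. -/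
def IsAdmissible (T : Set ℝ) (a b ya yb : ℝ) (y : ℝ → ℝ) : Prop :=
  IsC1prd T y ∧ y a = ya ∧ y b = yb

/-- The functional `∫_a^b L(t, y(t), y^Δ(t)) Δt`. -/
def functional (T : Set ℝ) (a b : ℝ) (L : ℝ → ℝ → ℝ → ℝ) (y : ℝ → ℝ) : ℝ :=
  deltaIntegral T (fun t => L t (y t) (deltaDeriv T y t)) a b

/-- Weak local minimizers of the problem with fixed endpoints. -/
def IsWeakLocalMinimizer (T : Set ℝ) (a b ya yb : ℝ) (L : ℝ → ℝ → ℝ → ℝ) (y : ℝ → ℝ) : Prop :=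
  IsAdmissible T a b ya yb y ∧
    ∃ δ : ℝ, 0 < δ ∧ ∀ z : ℝ → ℝ, IsAdmissible T a b ya yb z →
      norm1 T (fun t => y t - z t) < ENNReal.ofReal δ →
        functional T a b L y ≤ functional T a b L z

end TimeScale

end

/-!
The proof is the du Bois-Reymond argument, carried out with Lebesgue integrals.

**The integral.** Let `proj x` be the last point of the time scale not exceeding `x`. For piecewise
rd-continuous `f`, the function `f ∘ proj` is bounded and measurable on `[a, b]`, and
`t ↦ ∫_a^t f(proj x) dx` is an antiderivative of `f` (`isDeltaAntideriv_primitive`).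
Antiderivatives are unique up to a constant: if `H^Δ = 0` off finitely many points, then `H ∘ proj`
is continuous on `[a, b]` with derivative zero off a countable set
(`eq_of_hasDeltaDerivAt_zero`). Hence `∫_c^d f Δt = ∫_c^d f(proj x) dx` (`deltaIntegral_eq`), and
the convergence theorems of Lebesgue integration become available.

**The first variation.** If `η` is the primitive of a piecewise rd-continuous `g` and vanishes at
both ends, then `y + εη` is admissible and close to `y` in the norm `‖·‖_{1,∞}` for small `ε`.
Differentiating under the integral sign gives `∫ (L_y η + L_v g) Δt = 0` (`first_variation`).

**Choice of the direction.** Let `P` be the primitive of `L_y`. The product rule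
`(Pη)^Δ = P^Δ η + P^σ η^Δ` turns the first variation into `∫ (L_v - P^σ) g Δt = 0`. Choosing
`g = L_v - P^σ - c` with `c` the mean value of `L_v - P^σ` gives `∫ g² Δt = 0`, so that
`L_v = P^σ + c` at `proj x` for almost every `x` (`exists_ae_eq_of_variation_eq_zero`).

**From almost everywhere to everywhere.** A right-scattered point is the projection of a whole gap,
so the equation holds there. A right-dense point of `T^κ` is a limit of points at which the equation
holds, from every side it is approached from, and continuity of `L_v` gives the equation with the
one-sided limit of `y^Δ` (`euler_limit`). Where `y^Δ(t)` exists at a right-dense point, it equals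
that one-sided limit because `y` is a primitive of `y^Δ` (`IsC1prd.deltaDeriv_eq_limit`).
-/

noncomputable section

namespace TimeScale

/-! ### Time scales and their jump operators -/

/-- `T` is a compact time scale with minimum `a` and maximum `b`, and `a < b`. -/
structure IsTimeScale (T : Set ℝ) (a b : ℝ) : Prop where
  isClosed : IsClosed T
  isLeast : IsLeast T a
  isGreatest : IsGreatest T b
  lt : a < b

/-- The last point of `T` not exceeding `x`. On the gap `[t, σ(t))` it takes the value `t`, so
that `f ∘ proj T` extends `f` to an interval by step functions on the gaps. -/
def proj (T : Set ℝ) (x : ℝ) : ℝ := sSup (T ∩ Iic x)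

variable {T : Set ℝ} {a b : ℝ}

lemma sigma_le {s t : ℝ} (hs : s ∈ T) (hts : t < s) :
    sigma T t ≤ s := by
  rw [sigma, if_pos ⟨s, hs, hts⟩]
  exact csInf_le ⟨t, fun _ hr => hr.2.le⟩ ⟨hs, hts⟩

lemma countable_right_scattered : {t ∈ T | t < sigma T t}.Countable := by
  refine Set.PairwiseDisjoint.countable_of_Ioo (y := sigma T) ?_ fun t ht => ht.2
  have key : ∀ s ∈ T, ∀ t ∈ T, s < t → Disjoint (Ioo s (sigma T s)) (Ioo t (sigma T t)) :=
    fun s _ t ht hst => Set.disjoint_left.2 fun x hx hx' =>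
      (hx.2.trans_le (sigma_le ht hst)).not_gt hx'.1
  intro s hs t ht hst
  rcases hst.lt_or_gt with hlt | hlt
  · exact key s hs.1 t ht.1 hlt
  · exact (key t ht.1 s hs.1 hlt).symm

lemma le_proj {s x : ℝ} (hs : s ∈ T) (hx : s ≤ x) : s ≤ proj T x :=
  le_csSup ⟨x, fun _ hr => hr.2⟩ ⟨hs, hx⟩

namespace IsTimeScale

lemma sSup_eq (h : IsTimeScale T a b) : sSup T = b := h.isGreatest.csSup_eq

lemma subset_Icc (h : IsTimeScale T a b) : T ⊆ Icc a b :=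
  fun _ ht => ⟨h.isLeast.2 ht, h.isGreatest.2 ht⟩

lemma isCompact (h : IsTimeScale T a b) : IsCompact T :=
  isCompact_Icc.of_isClosed_subset h.isClosed h.subset_Icc

lemma sigma_max (h : IsTimeScale T a b) : sigma T b = b := by
  have : ¬ (T ∩ Ioi b).Nonempty := fun ⟨s, hs, hbs⟩ => (h.isGreatest.2 hs).not_gt hbs
  rw [sigma, if_neg this, h.sSup_eq]

lemma sigma_eq_sInf (h : IsTimeScale T a b) {t : ℝ} (ht : t < b) :
    sigma T t = sInf (T ∩ Ioi t) := if_pos ⟨b, h.isGreatest.1, ht⟩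

lemma le_sigma (h : IsTimeScale T a b) {t : ℝ} (ht : t ≤ b) : t ≤ sigma T t := by
  rcases ht.lt_or_eq with ht | rfl
  · rw [h.sigma_eq_sInf ht]
    exact le_csInf ⟨b, h.isGreatest.1, ht⟩ fun _ hr => hr.2.le
  · rw [h.sigma_max]

lemma sigma_mem (h : IsTimeScale T a b) (t : ℝ) : sigma T t ∈ T := by
  by_cases hne : (T ∩ Ioi t).Nonempty
  · rw [sigma, if_pos hne]
    have : sInf (T ∩ Ioi t) ∈ closure (T ∩ Ioi t) :=
      csInf_mem_closure hne ⟨t, fun _ hr => hr.2.le⟩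
    exact h.isClosed.closure_subset (closure_mono inter_subset_left this)
  · rw [sigma, if_neg hne, h.sSup_eq]
    exact h.isGreatest.1

/-- A right-dense point other than the maximum is a limit of points of `T` from the right. -/
lemma exists_mem_Ioo_right (h : IsTimeScale T a b) {t r : ℝ} (htb : t < b) (hσ : sigma T t = t)
    (htr : t < r) : ∃ s ∈ T, s ∈ Ioo t r := by
  rw [h.sigma_eq_sInf htb] at hσ
  obtain ⟨s, hs, hsr⟩ := exists_lt_of_csInf_lt (s := T ∩ Ioi t) ⟨b, h.isGreatest.1, htb⟩
    (hσ.symm ▸ htr)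
  exact ⟨s, hs.1, hs.2, hsr⟩

lemma mem_kappa (h : IsTimeScale T a b) {t : ℝ} (ht : t ∈ T) (htb : t < b) : t ∈ kappa T := by
  refine ⟨ht, fun hc => hc.1.not_ge ?_⟩
  rw [h.sSup_eq, rho, if_pos ⟨t, ht, htb⟩]
  exact le_csSup ⟨b, fun _ hr => hr.2.le⟩ ⟨ht, htb⟩

/-- The maximum of `T` belongs to `T^κ` only when it is left-dense. -/
lemma exists_mem_Ioo_left_max (h : IsTimeScale T a b) (hb : b ∈ kappa T) {r : ℝ} (hr : r < b) :
    ∃ s ∈ T, s ∈ Ioo r b := by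
  have hρ : b ≤ rho T b := by
    by_contra hc
    exact hb.2 (by rw [h.sSup_eq]; exact ⟨not_le.1 hc, le_rfl⟩)
  have hne : (T ∩ Iio b).Nonempty := ⟨a, h.isLeast.1, h.lt⟩
  rw [rho, if_pos hne] at hρ
  obtain ⟨s, hs, hrs⟩ := exists_lt_of_lt_csSup hne (hr.trans_le hρ)
  exact ⟨s, hs.1, hrs, hs.2⟩

lemma exists_ne_sigma (h : IsTimeScale T a b) {t : ℝ} (ht : t ∈ kappa T) :
    ∃ᶠ s in 𝓝[T] t, s ≠ sigma T t := by
  by_cases hσ : sigma T t = t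
  · rw [hσ]
    intro hev
    obtain ⟨l, r, ⟨hl, hr⟩, hlr⟩ :=
      mem_nhds_iff_exists_Ioo_subset.1 (eventually_nhdsWithin_iff.1 hev)
    rcases (h.isGreatest.2 ht.1).lt_or_eq with htb | rfl
    · obtain ⟨s, hs, hsm⟩ := h.exists_mem_Ioo_right htb hσ hr
      exact hlr ⟨hl.trans hsm.1, hsm.2⟩ hs hsm.1.ne'
    · obtain ⟨s, hs, hsm⟩ := h.exists_mem_Ioo_left_max ht hl
      exact hlr ⟨hsm.1, hsm.2.trans hr⟩ hs hsm.2.ne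
  · exact fun hc => hc.self_of_nhdsWithin ht.1 (Ne.symm hσ)

lemma proj_mem (h : IsTimeScale T a b) {x : ℝ} (hx : a ≤ x) : proj T x ∈ T :=
  ((h.isClosed.inter isClosed_Iic).csSup_mem ⟨a, h.isLeast.1, hx⟩ ⟨x, fun _ hr => hr.2⟩).1

lemma proj_le (h : IsTimeScale T a b) {x : ℝ} (hx : a ≤ x) : proj T x ≤ x :=
  csSup_le ⟨a, h.isLeast.1, hx⟩ fun _ hr => hr.2

lemma proj_mem_kappa (h : IsTimeScale T a b) {x : ℝ} (hx : a ≤ x) (hxb : x < b) :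
    proj T x ∈ kappa T := h.mem_kappa (h.proj_mem hx) ((h.proj_le hx).trans_lt hxb)

lemma proj_eq_self (h : IsTimeScale T a b) {t : ℝ} (ht : t ∈ T) : proj T t = t :=
  le_antisymm (h.proj_le (h.isLeast.2 ht)) (le_proj ht le_rfl)

lemma proj_mono (h : IsTimeScale T a b) {x x' : ℝ} (hx : a ≤ x) (hxx : x ≤ x') :
    proj T x ≤ proj T x' := le_proj (h.proj_mem hx) ((h.proj_le hx).trans hxx)

lemma le_sigma_proj (h : IsTimeScale T a b) {x : ℝ} (hx : a ≤ x) (hxb : x ≤ b) :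
    x ≤ sigma T (proj T x) := by
  by_contra! hc
  have h1 := le_proj (h.sigma_mem (proj T x)) hc.le
  have h2 := h.le_sigma ((h.proj_le hx).trans hxb)
  rcases ((h.proj_le hx).trans hxb).lt_or_eq with hb | hb
  · have hσ : sigma T (proj T x) = proj T x := le_antisymm h1 h2
    obtain ⟨s, hs, hs1, hs2⟩ := h.exists_mem_Ioo_right hb hσ (hσ ▸ hc)
    exact hs1.not_ge (le_proj hs hs2.le)
  · rw [hb, h.sigma_max] at hc
    exact hc.not_ge hxb

lemma proj_eq_of_mem_Ico (h : IsTimeScale T a b) {t x : ℝ} (ht : t ∈ T)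
    (hx : x ∈ Ico t (sigma T t)) : proj T x = t := by
  have hax : a ≤ x := (h.isLeast.2 ht).trans hx.1
  refine le_antisymm ?_ (le_proj ht hx.1)
  by_contra! hc
  exact ((sigma_le (h.proj_mem hax) hc).trans (h.proj_le hax)).not_gt hx.2

/-- A right-dense point is the projection of no point but itself. -/
lemma eq_of_proj_eq (h : IsTimeScale T a b) {t x : ℝ} (hx : a ≤ x) (hxb : x ≤ b)
    (hσ : sigma T t = t) (hp : proj T x = t) : x = t :=
  le_antisymm (by simpa [hp, hσ] using h.le_sigma_proj hx hxb) (hp ▸ h.proj_le hx)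

lemma isCompact_kappa (h : IsTimeScale T a b) : IsCompact (kappa T) := by
  by_cases hb : b ∈ kappa T
  · have : kappa T = T := by
      refine Subset.antisymm (fun t ht => ht.1) fun t ht => ?_
      rcases (h.isGreatest.2 ht).lt_or_eq with htb | rfl
      exacts [h.mem_kappa ht htb, hb]
    rw [this]
    exact h.isCompact
  · have hρ : rho T b < b := by
      by_contra! hc
      exact hb ⟨h.isGreatest.1, fun hc' => hc'.1.not_ge (by rwa [h.sSup_eq])⟩
    have : kappa T = T ∩ Iic (rho T b) := by
      ext t
      simp only [kappa, h.sSup_eq, Set.mem_sdiff, mem_Ioc, mem_inter_iff, mem_Iic, not_and, not_le]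
      refine and_congr_right fun ht => ⟨fun hc => ?_, fun hc h' => absurd hc h'.not_ge⟩
      by_contra! h'
      exact (hc h').not_ge (h.isGreatest.2 ht)
    rw [this]
    exact h.isCompact.inter_right isClosed_Iic

/-- The forward jump is continuous at `t` from either side, with limit `t`. -/
lemma tendsto_sigma (h : IsTimeScale T a b) {t : ℝ} (ht : t ∈ T) :
    Tendsto (sigma T) (𝓝[kappa T ∩ Ioi t] t) (𝓝[T] t) ∧
      Tendsto (sigma T) (𝓝[kappa T ∩ Iio t] t) (𝓝[T] t) := by
  have hmem : ∀ l : Filter ℝ, ∀ᶠ s in l, sigma T s ∈ T := fun l => .of_forall h.sigma_mem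
  refine ⟨tendsto_nhdsWithin_iff.2 ⟨?_, hmem _⟩, tendsto_nhdsWithin_iff.2 ⟨?_, hmem _⟩⟩
  · rw [tendsto_order]
    refine ⟨fun l hl => ?_, fun r hr => ?_⟩
    · filter_upwards [self_mem_nhdsWithin] with s hs
      exact (hl.trans hs.2).trans_le (h.le_sigma (h.isGreatest.2 hs.1.1))
    · by_cases hT : ∃ s ∈ T, s ∈ Ioo t r
      · obtain ⟨s, hs, hs1, hs2⟩ := hT
        filter_upwards [nhdsWithin_le_nhds (Iio_mem_nhds hs1)] with u hu
        exact (sigma_le hs hu).trans_lt hs2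
      · push Not at hT
        filter_upwards [nhdsWithin_le_nhds (Iio_mem_nhds hr), self_mem_nhdsWithin] with u hu hu'
        exact absurd ⟨hu'.2, hu⟩ (hT u hu'.1.1)
  · rw [tendsto_order]
    refine ⟨fun l hl => ?_, fun r hr => ?_⟩
    · filter_upwards [nhdsWithin_le_nhds (Ioi_mem_nhds hl), self_mem_nhdsWithin] with s hs hs'
      exact lt_of_lt_of_le hs (h.le_sigma (h.isGreatest.2 hs'.1.1))
    · filter_upwards [self_mem_nhdsWithin] with s hs
      exact (sigma_le ht hs.2).trans_lt hr

end IsTimeScale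

/-- Within `T^κ`, a neighbourhood of `t` splits into its two sides and the point itself. -/
lemma nhdsWithin_kappa_le (t : ℝ) :
    𝓝[kappa T] t ≤ 𝓝[kappa T ∩ Ioi t] t ⊔ 𝓝[kappa T ∩ Iio t] t ⊔ pure t := by
  rw [← nhdsWithin_singleton, ← nhdsWithin_union, ← nhdsWithin_union]
  refine nhdsWithin_mono _ fun s hs => ?_
  rcases lt_trichotomy s t with h | h | h
  exacts [.inl (.inr ⟨hs, h⟩), .inr h, .inl (.inl ⟨hs, h⟩)]

/-! ### Piecewise rd-continuous functions -/

namespace IsPiecewiseRdContinuous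

variable {f g : ℝ → ℝ}

lemma comp₂ (hf : IsPiecewiseRdContinuous T f) (hg : IsPiecewiseRdContinuous T g)
    {Φ : ℝ × ℝ → ℝ} (hΦ : Continuous Φ) :
    IsPiecewiseRdContinuous T (fun t => Φ (f t, g t)) := by
  obtain ⟨hf, E, hE, hfE⟩ := hf
  obtain ⟨hg, E', hE', hgE⟩ := hg
  refine ⟨fun t ht => ?_, E ∪ E', hE.union hE', fun t ht hσ => ?_⟩
  · obtain ⟨⟨l, hl⟩, m, hm⟩ := hf t ht
    obtain ⟨⟨l', hl'⟩, m', hm'⟩ := hg t ht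
    exact ⟨⟨_, (hΦ.tendsto (l, l')).comp (hl.prodMk_nhds hl')⟩,
      _, (hΦ.tendsto (m, m')).comp (hm.prodMk_nhds hm')⟩
  · exact hΦ.continuousAt.comp_continuousWithinAt (f := fun t => (f t, g t))
      ((hfE t ⟨ht.1, fun hc => ht.2 (.inl hc)⟩ hσ).prodMk
        (hgE t ⟨ht.1, fun hc => ht.2 (.inr hc)⟩ hσ))

/-- Changing a function at finitely many right-dense points preserves piecewise
rd-continuity. -/
lemma congr_off_finite (hf : IsPiecewiseRdContinuous T f) {E : Set ℝ} (hE : E.Finite)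
    (hfg : ∀ t ∈ kappa T \ E, f t = g t) : IsPiecewiseRdContinuous T g := by
  obtain ⟨hf, E', hE', hfE⟩ := hf
  have hev : ∀ t, ∀ S : Set ℝ, S ⊆ kappa T → t ∉ S → f =ᶠ[𝓝[S] t] g := by
    intro t S hS htS
    have hcl : (E \ {t})ᶜ ∈ 𝓝 t := (hE.subset sdiff_subset).isClosed.isOpen_compl.mem_nhds (by simp)
    filter_upwards [nhdsWithin_le_nhds hcl, self_mem_nhdsWithin] with s hs hsS
    exact hfg s ⟨hS hsS, fun hsE => hs ⟨hsE, fun hc => htS (hc ▸ hsS)⟩⟩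
  refine ⟨fun t ht => ?_, E ∪ E', hE.union hE', fun t ht hσ => ?_⟩
  · obtain ⟨⟨l, hl⟩, m, hm⟩ := hf t ht
    exact ⟨⟨l, hl.congr' (hev t _ inter_subset_left fun hc => lt_irrefl t hc.2)⟩,
      m, hm.congr' (hev t _ inter_subset_left fun hc => lt_irrefl t hc.2)⟩
  · have htE : t ∉ E := fun hc => ht.2 (.inl hc)
    refine (hfE t ⟨ht.1, fun hc => ht.2 (.inr hc)⟩ hσ).congr_of_eventuallyEq ?_
      (hfg t ⟨ht.1, htE⟩).symm
    filter_upwards [nhdsWithin_le_nhds (hE.isClosed.isOpen_compl.mem_nhds htE),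
      self_mem_nhdsWithin] with s hs hsS
    exact (hfg s ⟨hsS, hs⟩).symm

/-- Having one-sided limits everywhere on a compact set, `f` is bounded. -/
lemma exists_bound (h : IsTimeScale T a b) (hf : IsPiecewiseRdContinuous T f) :
    ∃ K, 0 < K ∧ ∀ t ∈ kappa T, |f t| ≤ K := by
  suffices ∃ K, ∀ t ∈ kappa T, |f t| ≤ K by
    obtain ⟨K, hK⟩ := this
    exact ⟨max K 1, by positivity, fun t ht => (hK t ht).trans (le_max_left _ _)⟩
  refine h.isCompact_kappa.induction_on (p := fun S => ∃ K, ∀ t ∈ S, |f t| ≤ K) ⟨0, by simp⟩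
    (fun S S' hS ⟨K, hK⟩ => ⟨K, fun t ht => hK t (hS ht)⟩)
    (fun S S' ⟨K, hK⟩ ⟨K', hK'⟩ => ⟨max K K', fun t ht => ?_⟩) fun t ht => ?_
  · exact ht.elim (fun ht => (hK t ht).trans (le_max_left _ _))
      fun ht => (hK' t ht).trans (le_max_right _ _)
  · obtain ⟨⟨l, hl⟩, m, hm⟩ := hf.1 t ht.1
    set K := max (max (|l| + 1) (|m| + 1)) |f t| with hK
    refine ⟨{s | |f s| ≤ K}, nhdsWithin_kappa_le t ?_, K, fun s hs => hs⟩
    refine mem_sup.2 ⟨mem_sup.2 ⟨?_, ?_⟩, ?_⟩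
    · filter_upwards [hl.abs.eventually_le_const (lt_add_one |l|)] with s hs
      exact hs.trans ((le_max_left _ _).trans (le_max_left _ _))
    · filter_upwards [hm.abs.eventually_le_const (lt_add_one |m|)] with s hs
      exact hs.trans ((le_max_right _ _).trans (le_max_left _ _))
    · exact le_max_right (max (|l| + 1) (|m| + 1)) |f t|

/-- A piecewise rd-continuous function is continuous on `T^κ` off a countable set, because there
are only countably many right-scattered points. Hence it is measurable. -/
lemma measurable_indicator (h : IsTimeScale T a b) (hf : IsPiecewiseRdContinuous T f) :
    Measurable ((kappa T).indicator f) := by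
  obtain ⟨-, E, hE, hfE⟩ := hf
  set C : Set ℝ := E ∪ {t ∈ T | t < sigma T t}
  have hC : C.Countable := hE.countable.union countable_right_scattered
  have hcont : ContinuousOn f (kappa T \ C) := by
    intro t ht
    refine (hfE t ⟨ht.1, fun hc => ht.2 (.inl hc)⟩ ?_).mono sdiff_subset
    exact le_antisymm (not_lt.1 fun hc => ht.2 (.inr ⟨ht.1.1, hc⟩))
      (h.le_sigma (h.isGreatest.2 ht.1.1))
  refine measurable_of_measurable_on_compl_countable C hC ?_
  have hm : Measurable ((kappa T \ C).indicator f) := by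
    classical
    rw [← piecewise_eq_indicator]
    exact hcont.measurable_piecewise continuousOn_const
      (h.isCompact_kappa.isClosed.measurableSet.diff hC.measurableSet)
  convert hm.comp (measurable_subtype_coe (p := fun x => x ∈ Cᶜ)) using 1
  ext ⟨x, hx⟩
  by_cases hxk : x ∈ kappa T
  · have : x ∈ kappa T \ C := ⟨hxk, hx⟩
    simp [domRestrict, hxk, this]
  · have : x ∉ kappa T \ C := fun hc => hxk hc.1
    simp [domRestrict, hxk, this]

lemma aestronglyMeasurable_proj (h : IsTimeScale T a b) (hf : IsPiecewiseRdContinuous T f) :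
    MeasureTheory.AEStronglyMeasurable (fun x => f (proj T x))
      (MeasureTheory.volume.restrict (Ioo a b)) := by
  have hp : AEMeasurable (proj T) (MeasureTheory.volume.restrict (Ioo a b)) :=
    aemeasurable_restrict_of_monotoneOn measurableSet_Ioo
      fun x hx x' _ hxx => h.proj_mono hx.1.le hxx
  refine ((hf.measurable_indicator h).comp_aemeasurable hp).aestronglyMeasurable.congr ?_
  filter_upwards [MeasureTheory.ae_restrict_mem measurableSet_Ioo] with x hx
  exact indicator_of_mem (h.proj_mem_kappa hx.1.le hx.2) f

lemma intervalIntegrable_proj (h : IsTimeScale T a b) (hf : IsPiecewiseRdContinuous T f)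
    {c d : ℝ} (hc : c ∈ Icc a b) (hd : d ∈ Icc a b) :
    IntervalIntegrable (fun x => f (proj T x)) MeasureTheory.volume c d := by
  suffices IntervalIntegrable (fun x => f (proj T x)) MeasureTheory.volume a b by
    refine this.mono_set ?_
    rw [uIcc_of_le h.lt.le]
    exact uIcc_subset_Icc hc hd
  rw [intervalIntegrable_iff_integrableOn_Ioo_of_le h.lt.le]
  obtain ⟨K, -, hK⟩ := hf.exists_bound h
  refine MeasureTheory.Integrable.of_bound (hf.aestronglyMeasurable_proj h) K ?_
  filter_upwards [MeasureTheory.ae_restrict_mem measurableSet_Ioo] with x hx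
  exact hK _ (h.proj_mem_kappa hx.1.le hx.2)

end IsPiecewiseRdContinuous

lemma IsPiecewiseRdContinuous.of_continuousOn {f : ℝ → ℝ}
    (hf : ContinuousOn f T) : IsPiecewiseRdContinuous T f := by
  have hk : kappa T ⊆ T := fun t ht => ht.1
  exact ⟨fun t ht => ⟨⟨f t, (hf t ht).mono_left (nhdsWithin_mono _ (inter_subset_left.trans hk))⟩,
    f t, (hf t ht).mono_left (nhdsWithin_mono _ (inter_subset_left.trans hk))⟩,
    ∅, finite_empty, fun t ht _ => (hf t ht.1.1).mono hk⟩

/-- A continuous function composed with the forward jump is piecewise rd-continuous; it is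
continuous at every right-dense point. -/
lemma IsPiecewiseRdContinuous.comp_sigma (h : IsTimeScale T a b) {f : ℝ → ℝ}
    (hf : ContinuousOn f T) : IsPiecewiseRdContinuous T (fun t => f (sigma T t)) := by
  have key : ∀ t ∈ T, Tendsto (fun s => f (sigma T s)) (𝓝[kappa T ∩ Ioi t] t) (𝓝 (f t)) ∧
      Tendsto (fun s => f (sigma T s)) (𝓝[kappa T ∩ Iio t] t) (𝓝 (f t)) := fun t ht =>
    ⟨(hf t ht).tendsto.comp (h.tendsto_sigma ht).1, (hf t ht).tendsto.comp (h.tendsto_sigma ht).2⟩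
  refine ⟨fun t ht => ⟨⟨_, (key t ht).1⟩, _, (key t ht).2⟩, ∅, finite_empty, fun t ht hσ => ?_⟩
  refine Tendsto.mono_left ?_ (nhdsWithin_kappa_le t)
  have h1 := key t ht.1.1
  refine Tendsto.sup ?_ (tendsto_pure_nhds (fun s => f (sigma T s)) t)
  simp only [hσ]
  exact h1.1.sup h1.2

/-! ### Delta derivatives -/

lemma hasDeltaDerivAt_iff_isLittleO {f : ℝ → ℝ} {f' t : ℝ} :
    HasDeltaDerivAt T f f' t ↔
      (fun s => f (sigma T t) - f s - f' * (sigma T t - s)) =o[𝓝[T] t] fun s => sigma T t - s := by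
  simp only [Asymptotics.isLittleO_iff, HasDeltaDerivAt, Real.norm_eq_abs, gt_iff_lt]

lemma HasDeltaDerivAt.unique (h : IsTimeScale T a b) {f : ℝ → ℝ} {f' f'' t : ℝ}
    (ht : t ∈ kappa T) (h' : HasDeltaDerivAt T f f' t) (h'' : HasDeltaDerivAt T f f'' t) :
    f' = f'' := by
  rw [hasDeltaDerivAt_iff_isLittleO] at h' h''
  have h3 : (fun s => (f'' - f') * (sigma T t - s)) =o[𝓝[T] t] fun s => sigma T t - s :=
    (h'.sub h'').congr_left fun s => by ring
  by_contra hne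
  have h4 := (Asymptotics.isLittleO_const_mul_left_iff (sub_ne_zero.2 (Ne.symm hne))).1 h3
  refine (h.exists_ne_sigma ht) ?_
  filter_upwards [(Asymptotics.isLittleO_iff.1 h4) (half_pos one_pos)] with s hs hs'
  have : 0 < ‖sigma T t - s‖ := norm_pos_iff.2 (sub_ne_zero.2 hs'.symm)
  linarith

lemma HasDeltaDerivAt.deltaDeriv_eq (h : IsTimeScale T a b) {f : ℝ → ℝ} {f' t : ℝ}
    (ht : t ∈ kappa T) (hf : HasDeltaDerivAt T f f' t) : deltaDeriv T f t = f' := by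
  have hd : DeltaDifferentiableAt T f t := ⟨f', hf⟩
  rw [deltaDeriv, dif_pos hd]
  exact hd.choose_spec.unique h ht hf

lemma DeltaDifferentiableAt.hasDeltaDerivAt {f : ℝ → ℝ} {t : ℝ}
    (hf : DeltaDifferentiableAt T f t) : HasDeltaDerivAt T f (deltaDeriv T f t) t := by
  rw [deltaDeriv, dif_pos hf]
  exact hf.choose_spec

lemma HasDeltaDerivAt.add_const_mul {f g : ℝ → ℝ} {f' g' t : ℝ} (hf : HasDeltaDerivAt T f f' t)
    (hg : HasDeltaDerivAt T g g' t) (c : ℝ) :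
    HasDeltaDerivAt T (fun s => f s + c * g s) (f' + c * g') t := by
  rw [hasDeltaDerivAt_iff_isLittleO] at hf hg ⊢
  exact (hf.add (hg.const_mul_left c)).congr_left fun s => by ring

/-- The product rule `(fg)^Δ = f^Δ g + f^σ g^Δ`. -/
lemma HasDeltaDerivAt.mul {f g : ℝ → ℝ} {f' g' t : ℝ} (hf : HasDeltaDerivAt T f f' t)
    (hg : HasDeltaDerivAt T g g' t) (hgc : ContinuousWithinAt g T t) :
    HasDeltaDerivAt T (fun s => f s * g s) (f' * g t + f (sigma T t) * g') t := by
  rw [hasDeltaDerivAt_iff_isLittleO] at hf hg ⊢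
  have h1 := hg.const_mul_left (f (sigma T t))
  have h2 := (hgc.tendsto.isBigO_one ℝ).mul_isLittleO hf
  have h3 : (fun s => (g s - g t) * (f' * (sigma T t - s))) =o[𝓝[T] t]
      fun s => (1 : ℝ) * (sigma T t - s) := by
    refine Asymptotics.IsLittleO.mul_isBigO ?_ ((Asymptotics.isBigO_refl _ _).const_mul_left f')
    rw [Asymptotics.isLittleO_one_iff]
    simpa using hgc.tendsto.sub_const (g t)
  simp only [one_mul] at h2 h3
  exact ((h1.add h2).add h3).congr_left fun s => by ring

/-- At a right-scattered point a continuous function has the difference quotient over the gap as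
its delta derivative. -/
lemma HasDeltaDerivAt.of_right_scattered {f : ℝ → ℝ} {f' t : ℝ} (hf : ContinuousWithinAt f T t)
    (ht : t < sigma T t) (hf' : f (sigma T t) - f t = f' * (sigma T t - t)) :
    HasDeltaDerivAt T f f' t := by
  intro ε hε
  have h1 : ContinuousWithinAt
      (fun s => ε * |sigma T t - s| - |f (sigma T t) - f s - f' * (sigma T t - s)|) T t := by
    fun_prop
  have h2 : 0 < ε * |sigma T t - t| - |f (sigma T t) - f t - f' * (sigma T t - t)| := by
    have : 0 < |sigma T t - t| := abs_pos.2 (sub_pos.2 ht).ne'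
    rw [hf', sub_self, abs_zero, sub_zero]
    positivity
  filter_upwards [h1.tendsto.eventually_const_lt h2] with s hs
  linarith

/-- The delta derivative of a Lipschitz function is bounded by the Lipschitz constant. -/
lemma HasDeltaDerivAt.abs_le (h : IsTimeScale T a b) {f : ℝ → ℝ} {f' t K : ℝ} (ht : t ∈ kappa T)
    (hf : HasDeltaDerivAt T f f' t) (hK : ∀ r ∈ T, ∀ s ∈ T, |f r - f s| ≤ K * |r - s|) :
    |f'| ≤ K := by
  refine le_of_forall_pos_le_add fun ε hε => ?_
  obtain ⟨s, hs, hsT, hs'⟩ := ((h.exists_ne_sigma ht).and_eventually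
    ((eventually_mem_nhdsWithin (s := T)).and (hf ε hε))).exists
  have hpos : 0 < |sigma T t - s| := abs_pos.2 (sub_ne_zero.2 hs.symm)
  have h1 := hK _ (h.sigma_mem t) s hsT
  have h2 : |f' * (sigma T t - s)| ≤ |f (sigma T t) - f s| +
      |f (sigma T t) - f s - f' * (sigma T t - s)| := by
    have := abs_sub (f (sigma T t) - f s) (f (sigma T t) - f s - f' * (sigma T t - s))
    simpa using this
  rw [abs_mul] at h2
  exact le_of_mul_le_mul_right (by linarith) hpos

/-! ### The delta integral as a Lebesgue integral -/

/-- The primitive `t ↦ ∫_a^t f(proj x) dx`. -/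
def primitive (T : Set ℝ) (a : ℝ) (f : ℝ → ℝ) (t : ℝ) : ℝ := ∫ x in a..t, f (proj T x)

section Primitive

variable {f : ℝ → ℝ}

lemma primitive_sub (h : IsTimeScale T a b) (hf : IsPiecewiseRdContinuous T f) {c d : ℝ}
    (hc : c ∈ Icc a b) (hd : d ∈ Icc a b) :
    primitive T a f d - primitive T a f c = ∫ x in c..d, f (proj T x) :=
  intervalIntegral.integral_interval_sub_left
    (hf.intervalIntegrable_proj h (left_mem_Icc.2 h.lt.le) hd)
    (hf.intervalIntegrable_proj h (left_mem_Icc.2 h.lt.le) hc)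

lemma continuousOn_primitive (h : IsTimeScale T a b) (hf : IsPiecewiseRdContinuous T f) :
    ContinuousOn (primitive T a f) (Icc a b) := by
  have h1 := hf.intervalIntegrable_proj h (left_mem_Icc.2 h.lt.le) (right_mem_Icc.2 h.lt.le)
  rw [intervalIntegrable_iff' ] at h1
  rw [← uIcc_of_le h.lt.le]
  exact intervalIntegral.continuousOn_primitive_interval h1

/-- A bound for `f - c` on the points of `T^κ` between two points of the time scale controls the
integral. -/
lemma abs_integral_sub_const_le (h : IsTimeScale T a b) (hf : IsPiecewiseRdContinuous T f)
    {r s c K : ℝ} (hr : r ∈ T) (hs : s ∈ T) (hK : ∀ t ∈ kappa T ∩ uIcc r s, |f t - c| ≤ K) :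
    |(∫ x in r..s, f (proj T x)) - c * (s - r)| ≤ K * |s - r| := by
  have hr' := h.subset_Icc hr
  have hs' := h.subset_Icc hs
  have : (∫ x in r..s, f (proj T x)) - c * (s - r) = ∫ x in r..s, (f (proj T x) - c) := by
    rw [intervalIntegral.integral_sub (hf.intervalIntegrable_proj h hr' hs')
      intervalIntegrable_const, intervalIntegral.integral_const, smul_eq_mul, mul_comm]
  rw [this, ← Real.norm_eq_abs]
  refine intervalIntegral.norm_integral_le_of_norm_le_const_ae ?_
  filter_upwards [MeasureTheory.volume.ae_ne b] with x hxb hx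
  have hx' : x ∈ uIcc r s := uIoc_subset_uIcc hx
  have hxab : x ∈ Icc a b := uIcc_subset_Icc hr' hs' hx'
  refine hK _ ⟨h.proj_mem_kappa hxab.1 (hxab.2.lt_of_ne hxb), ?_, ?_⟩
  · rcases min_choice r s with hm | hm <;> rw [hm] <;>
      exact le_proj (by assumption) (hm ▸ hx'.1)
  · exact (h.proj_le hxab.1).trans hx'.2

lemma integral_gap (h : IsTimeScale T a b) {t : ℝ} (ht : t ∈ T) :
    ∫ x in t..sigma T t, f (proj T x) = f t * (sigma T t - t) := by
  have : ∫ x in t..sigma T t, f (proj T x) = ∫ x in t..sigma T t, f t := by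
    refine intervalIntegral.integral_congr_ae ?_
    filter_upwards [MeasureTheory.volume.ae_ne (sigma T t)] with x hx hxm
    rw [uIoc_of_le (h.le_sigma (h.isGreatest.2 ht))] at hxm
    rw [h.proj_eq_of_mem_Ico ht ⟨hxm.1.le, hxm.2.lt_of_ne hx⟩]
  rw [this, intervalIntegral.integral_const, smul_eq_mul, mul_comm]

/-- Every piecewise rd-continuous function has an antiderivative. -/
lemma isDeltaAntideriv_primitive (h : IsTimeScale T a b) (hf : IsPiecewiseRdContinuous T f) :
    IsDeltaAntideriv T f (primitive T a f) := by
  have hcont := (continuousOn_primitive h hf).mono h.subset_Icc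
  obtain ⟨E, hE, hfE⟩ := hf.2
  refine ⟨hcont, {t ∈ E | sigma T t = t}, hE.subset (sep_subset _ _), fun t ht => ht.2,
    fun t ht => ?_⟩
  have htT : t ∈ T := ht.1.1
  have ht' := h.subset_Icc htT
  rcases (h.le_sigma ht'.2).lt_or_eq with hσ | hσ
  · refine .of_right_scattered (hcont t htT) hσ ?_
    rw [primitive_sub h hf ht' (h.subset_Icc (h.sigma_mem t)), integral_gap h htT]
  · have hfc := hfE t ⟨ht.1, fun hc => ht.2 ⟨hc, hσ.symm⟩⟩ hσ.symm
    intro ε hε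
    rw [← hσ]
    obtain ⟨δ, hδ, hδf⟩ := Metric.continuousWithinAt_iff.1 hfc ε hε
    filter_upwards [self_mem_nhdsWithin, nhdsWithin_le_nhds (Metric.ball_mem_nhds t hδ)]
      with s hs hsδ
    rw [primitive_sub h hf (h.subset_Icc hs) ht']
    refine abs_integral_sub_const_le h hf hs htT fun r hr => ?_
    have hrs : |r - t| ≤ |s - t| := by
      rw [abs_sub_comm, abs_sub_comm s]
      exact abs_sub_right_of_mem_uIcc hr.2
    refine (hδf hr.1 ?_).le
    exact hrs.trans_lt hsδ

end Primitive

/-- A continuous function whose delta derivative vanishes off a finite set is constant. Composed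
with `proj`, it becomes a continuous function on `[a, b]` whose ordinary derivative vanishes off a
countable set. -/
lemma eq_of_hasDeltaDerivAt_zero (h : IsTimeScale T a b) {H : ℝ → ℝ} (hH : ContinuousOn H T)
    {E : Set ℝ} (hE : E.Finite) (hH' : ∀ t ∈ kappa T \ E, sigma T t = t → HasDeltaDerivAt T H 0 t)
    (hgap : ∀ t ∈ T, t < sigma T t → H (sigma T t) = H t) {t : ℝ} (ht : t ∈ T) :
    H t = H a := by
  -- The value at `u` is attained at a point of `T` no farther from `x ∈ T` than `u`.
  have key : ∀ x ∈ T, ∀ u ∈ Icc a b, ∃ s ∈ T, H (proj T u) = H s ∧ |s - x| ≤ |u - x| := by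
    intro x hx u hu
    rcases le_or_gt x u with hxu | hxu
    · refine ⟨_, h.proj_mem hu.1, rfl, ?_⟩
      have h1 := le_proj hx hxu
      have h2 := h.proj_le hu.1
      rw [abs_of_nonneg (by linarith), abs_of_nonneg (by linarith)]
      linarith
    · have h0 := h.proj_mem hu.1
      have h1 : sigma T (proj T u) ≤ x := sigma_le hx ((h.proj_le hu.1).trans_lt hxu)
      have h2 := h.le_sigma_proj hu.1 hu.2
      refine ⟨_, h.sigma_mem (proj T u), ?_, ?_⟩
      · rcases (h.le_sigma (h.isGreatest.2 h0)).lt_or_eq with hlt | heq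
        exacts [(hgap _ h0 hlt).symm, by rw [← heq]]
      · rw [abs_of_nonpos (by linarith), abs_of_nonpos (by linarith)]
        linarith
  have hloc : ∀ x ∈ Icc a b, x ∉ T → (fun u => H (proj T u)) =ᶠ[𝓝 x] fun _ => H (proj T x) := by
    intro x hx hxT
    have h0 := h.proj_mem hx.1
    have h1 : proj T x < x := (h.proj_le hx.1).lt_of_ne fun hc => hxT (hc ▸ h0)
    have h2 : x < sigma T (proj T x) :=
      (h.le_sigma_proj hx.1 hx.2).lt_of_ne fun hc => hxT (hc ▸ h.sigma_mem _)
    filter_upwards [Ioo_mem_nhds h1 h2] with u hu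
    rw [h.proj_eq_of_mem_Ico h0 ⟨hu.1.le, hu.2⟩]
  have hcont : ContinuousOn (fun u => H (proj T u)) (Icc a b) := by
    intro x hx
    by_cases hxT : x ∈ T
    · rw [Metric.continuousWithinAt_iff]
      intro ε hε
      obtain ⟨δ, hδ, hδH⟩ := Metric.continuousWithinAt_iff.1 (hH x hxT) ε hε
      refine ⟨δ, hδ, fun {u} hu hux => ?_⟩
      obtain ⟨s, hs, hsu, hsx⟩ := key x hxT u hu
      rw [hsu, h.proj_eq_self hxT]
      exact hδH hs (lt_of_le_of_lt hsx hux)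
    · exact (continuousAt_const.congr (hloc x hx hxT).symm).continuousWithinAt
  have hC : (E ∪ {t ∈ T | t < sigma T t}).Countable :=
    hE.countable.union countable_right_scattered
  have hderiv : ∀ x ∈ Ioo a b \ (E ∪ {t ∈ T | t < sigma T t}),
      HasDerivAt (fun u => H (proj T u)) 0 x := by
    rintro x ⟨hx, hxC⟩
    by_cases hxT : x ∈ T
    · have hσ : sigma T x = x :=
        le_antisymm (not_lt.1 fun hc => hxC (.inr ⟨hxT, hc⟩)) (h.le_sigma hx.2.le)
      have hd := hH' x ⟨h.mem_kappa hxT hx.2, fun hc => hxC (.inl hc)⟩ hσ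
      rw [hasDerivAt_iff_isLittleO, Asymptotics.isLittleO_iff]
      intro ε hε
      obtain ⟨δ, hδ, hδH⟩ := Metric.eventually_nhds_iff.1 (eventually_nhdsWithin_iff.1 (hd ε hε))
      filter_upwards [Metric.ball_mem_nhds x hδ, Icc_mem_nhds hx.1 hx.2] with u hu huI
      obtain ⟨s, hs, hsu, hsx⟩ := key x hxT u huI
      have h1 := hδH (lt_of_le_of_lt hsx hu) hs
      rw [hσ, zero_mul, sub_zero, abs_sub_comm, abs_sub_comm x] at h1
      rw [hsu, h.proj_eq_self hxT, smul_zero, sub_zero, Real.norm_eq_abs, Real.norm_eq_abs]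
      exact h1.trans (mul_le_mul_of_nonneg_left hsx hε.le)
    · exact (hasDerivAt_const x _).congr_of_eventuallyEq (hloc x (Ioo_subset_Icc_self hx) hxT)
  have ht' := h.subset_Icc ht
  have := MeasureTheory.integral_eq_of_hasDerivAt_off_countable_of_le (fun u => H (proj T u))
    (fun _ => 0) ht'.1 hC (hcont.mono (Icc_subset_Icc_right ht'.2))
    (fun x hx => hderiv x ⟨⟨hx.1.1, hx.1.2.trans_le ht'.2⟩, hx.2⟩) intervalIntegrable_const
  simp only [h.proj_eq_self ht, h.proj_eq_self h.isLeast.1,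
    intervalIntegral.integral_zero] at this
  linarith

lemma HasDeltaDerivAt.sub_eq (h : IsTimeScale T a b) {f : ℝ → ℝ} {f' t : ℝ}
    (ht : t ∈ T) (hf : HasDeltaDerivAt T f f' t) :
    f (sigma T t) - f t = f' * (sigma T t - t) := by
  rw [← sub_eq_zero, ← abs_nonpos_iff]
  refine le_of_forall_pos_le_add fun ε hε => ?_
  have hnn : 0 ≤ sigma T t - t := sub_nonneg.2 (h.le_sigma (h.isGreatest.2 ht))
  have := (hf (ε / (sigma T t - t + 1)) (by positivity)).self_of_nhdsWithin ht
  rw [abs_of_nonneg hnn] at this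
  refine this.trans ?_
  rw [zero_add, div_mul_eq_mul_div, div_le_iff₀ (by positivity)]
  nlinarith

lemma IsDeltaAntideriv.sub_eq_integral (h : IsTimeScale T a b) {f F : ℝ → ℝ}
    (hf : IsPiecewiseRdContinuous T f) (hF : IsDeltaAntideriv T f F) {c d : ℝ} (hc : c ∈ T)
    (hd : d ∈ T) : F d - F c = ∫ x in c..d, f (proj T x) := by
  obtain ⟨hGc, E', hE', hEσ', hG⟩ := isDeltaAntideriv_primitive h hf
  obtain ⟨hFc, E, hE, hEσ, hF⟩ := hF
  have hd0 : ∀ t ∈ kappa T \ (E ∪ E'),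
      HasDeltaDerivAt T (fun s => F s + -1 * primitive T a f s) 0 t := by
    intro t ht
    have := (hF t ⟨ht.1, fun hc => ht.2 (.inl hc)⟩).add_const_mul
      (hG t ⟨ht.1, fun hc => ht.2 (.inr hc)⟩) (-1)
    simpa using this
  have key : ∀ t ∈ T, F t + -1 * primitive T a f t = F a + -1 * primitive T a f a := by
    refine fun t ht => eq_of_hasDeltaDerivAt_zero h (H := fun s => F s + -1 * primitive T a f s)
      (hFc.add (hGc.const_smul (-1 : ℝ))) (hE.union hE') (fun t ht _ => hd0 t ht)
      (fun t ht hσ => ?_) ht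
    have htE : t ∉ E ∪ E' := fun hc => hc.elim (fun hc => hσ.ne' (hEσ t hc))
      fun hc => hσ.ne' (hEσ' t hc)
    have htb : t < b := hσ.trans_le (h.isGreatest.2 (h.sigma_mem t))
    have := (hd0 t ⟨h.mem_kappa ht htb, htE⟩).sub_eq h ht
    simp only [zero_mul] at this
    linarith
  rw [← primitive_sub h hf (h.subset_Icc hc) (h.subset_Icc hd)]
  linarith [key c hc, key d hd]

lemma deltaIntegral_eq (h : IsTimeScale T a b) {f : ℝ → ℝ} (hf : IsPiecewiseRdContinuous T f)
    {c d : ℝ} (hc : c ∈ T) (hd : d ∈ T) :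
    deltaIntegral T f c d = ∫ x in c..d, f (proj T x) := by
  have hex : ∃ F, IsDeltaAntideriv T f F := ⟨_, isDeltaAntideriv_primitive h hf⟩
  rw [deltaIntegral, dif_pos hex]
  exact hex.choose_spec.sub_eq_integral h hf hc hd

/-- Only a null set projects onto finitely many right-dense points, so the values of a function
there do not affect its integral. -/
lemma ae_proj_notMem (h : IsTimeScale T a b) {E : Set ℝ} (hE : E.Finite)
    (hEσ : ∀ t ∈ E, sigma T t = t) :
    ∀ᵐ x, x ∈ Ioo a b → proj T x ∉ E := by
  filter_upwards [hE.countable.ae_notMem MeasureTheory.volume] with x hx hxab hc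
  exact hx (h.eq_of_proj_eq hxab.1.le hxab.2.le (hEσ _ hc) rfl ▸ hc)

/-! ### Functions of class `C^1_prd` as primitives -/

section Antiderivatives

variable {f g F G : ℝ → ℝ}

lemma IsDeltaAntideriv.congr_off_finite (hF : IsDeltaAntideriv T f F) {E : Set ℝ}
    (hE : E.Finite) (hEσ : ∀ t ∈ E, sigma T t = t) (hfg : ∀ t ∈ kappa T \ E, f t = g t) :
    IsDeltaAntideriv T g F := by
  obtain ⟨hFc, E', hE', hEσ', hF⟩ := hF
  refine ⟨hFc, E' ∪ E, hE'.union hE, fun t ht => ht.elim (hEσ' t) (hEσ t), fun t ht => ?_⟩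
  rw [← hfg t ⟨ht.1, fun hc => ht.2 (.inr hc)⟩]
  exact hF t ⟨ht.1, fun hc => ht.2 (.inl hc)⟩

lemma IsDeltaAntideriv.add_const_mul (hF : IsDeltaAntideriv T f F) (hG : IsDeltaAntideriv T g G)
    (c : ℝ) : IsDeltaAntideriv T (fun t => f t + c * g t) (fun t => F t + c * G t) := by
  obtain ⟨hFc, E, hE, hEσ, hF⟩ := hF
  obtain ⟨hGc, E', hE', hEσ', hG⟩ := hG
  exact ⟨hFc.add (continuousOn_const.mul hGc), E ∪ E', hE.union hE',
    fun t ht => ht.elim (hEσ t) (hEσ' t), fun t ht =>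
      (hF t ⟨ht.1, fun hc => ht.2 (.inl hc)⟩).add_const_mul
        (hG t ⟨ht.1, fun hc => ht.2 (.inr hc)⟩) c⟩

lemma IsDeltaAntideriv.mul (hF : IsDeltaAntideriv T f F) (hG : IsDeltaAntideriv T g G) :
    IsDeltaAntideriv T (fun t => f t * G t + F (sigma T t) * g t) (fun t => F t * G t) := by
  obtain ⟨hFc, E, hE, hEσ, hF⟩ := hF
  obtain ⟨hGc, E', hE', hEσ', hG⟩ := hG
  exact ⟨hFc.mul hGc, E ∪ E', hE.union hE', fun t ht => ht.elim (hEσ t) (hEσ' t), fun t ht =>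
    (hF t ⟨ht.1, fun hc => ht.2 (.inl hc)⟩).mul (hG t ⟨ht.1, fun hc => ht.2 (.inr hc)⟩)
      (hGc t ht.1.1)⟩

lemma IsDeltaAntideriv.deltaDeriv_eq (h : IsTimeScale T a b) (hF : IsDeltaAntideriv T f F) :
    ∃ E : Set ℝ, E.Finite ∧ (∀ t ∈ E, sigma T t = t) ∧
      ∀ t ∈ kappa T \ E, DeltaDifferentiableAt T F t ∧ deltaDeriv T F t = f t := by
  obtain ⟨-, E, hE, hEσ, hF⟩ := hF
  exact ⟨E, hE, hEσ, fun t ht => ⟨⟨_, hF t ht⟩, (hF t ht).deltaDeriv_eq h ht.1⟩⟩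

lemma IsDeltaAntideriv.isC1prd (h : IsTimeScale T a b) (hf : IsPiecewiseRdContinuous T f)
    (hF : IsDeltaAntideriv T f F) : IsC1prd T F := by
  obtain ⟨E, hE, -, hFE⟩ := hF.deltaDeriv_eq h
  exact ⟨hF.1, ⟨E, hE, fun t ht => (hFE t ht).1⟩,
    hf.congr_off_finite hE fun t ht => (hFE t ht).2.symm⟩

lemma IsDeltaAntideriv.ae_deltaDeriv_eq (h : IsTimeScale T a b) (hF : IsDeltaAntideriv T f F) :
    ∀ᵐ x, x ∈ Ioo a b → deltaDeriv T F (proj T x) = f (proj T x) := by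
  obtain ⟨E, hE, hEσ, hFE⟩ := hF.deltaDeriv_eq h
  filter_upwards [ae_proj_notMem h hE hEσ] with x hx hxab
  exact (hFE _ ⟨h.proj_mem_kappa hxab.1.le hxab.2, hx hxab⟩).2

/-- Continuity forces differentiability at right-scattered points. -/
lemma sigma_eq_of_not_deltaDifferentiableAt (h : IsTimeScale T a b) (hF : ContinuousOn F T)
    {t : ℝ} (ht : t ∈ T) (hFt : ¬ DeltaDifferentiableAt T F t) : sigma T t = t := by
  refine ((h.le_sigma (h.isGreatest.2 ht)).eq_of_not_lt fun hσ => hFt ?_).symm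
  exact ⟨(F (sigma T t) - F t) / (sigma T t - t), .of_right_scattered (hF t ht) hσ
    (div_mul_cancel₀ _ (sub_pos.2 hσ).ne').symm⟩

lemma IsC1prd.isDeltaAntideriv (h : IsTimeScale T a b) (hF : IsC1prd T F) :
    IsDeltaAntideriv T (deltaDeriv T F) F := by
  obtain ⟨hFc, ⟨E, hE, hFE⟩, -⟩ := hF
  refine ⟨hFc, {t ∈ E | t ∈ T ∧ ¬ DeltaDifferentiableAt T F t}, hE.subset (sep_subset _ _),
    fun t ht => sigma_eq_of_not_deltaDifferentiableAt h hFc ht.2.1 ht.2.2, fun t ht => ?_⟩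
  refine DeltaDifferentiableAt.hasDeltaDerivAt ?_
  by_contra hc
  exact hc (hFE t ⟨ht.1, fun hcE => ht.2 ⟨hcE, ht.1.1, hc⟩⟩)

lemma abs_primitive_sub_le (h : IsTimeScale T a b) (hf : IsPiecewiseRdContinuous T f) {K : ℝ}
    (hK : ∀ t ∈ kappa T, |f t| ≤ K) {r s : ℝ} (hr : r ∈ T) (hs : s ∈ T) :
    |primitive T a f r - primitive T a f s| ≤ K * |r - s| := by
  rw [primitive_sub h hf (h.subset_Icc hs) (h.subset_Icc hr)]
  simpa using abs_integral_sub_const_le h hf (c := 0) hs hr fun t ht => by simpa using hK t ht.1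

/-- At a right-dense point, an existing delta derivative agrees with the limit of the delta
derivative from each side `S` that `t` is approached from. -/
lemma IsC1prd.deltaDeriv_eq_limit (h : IsTimeScale T a b) (hF : IsC1prd T F) {t d v : ℝ}
    (ht : t ∈ T) (hσ : sigma T t = t) (hd : HasDeltaDerivAt T F d t) {S : Set ℝ} (htS : t ∉ S)
    (hS : ∀ s ∈ S, uIcc t s \ {t} ⊆ S) [(𝓝[kappa T ∩ S] t).NeBot]
    (hv : Tendsto (deltaDeriv T F) (𝓝[kappa T ∩ S] t) (𝓝 v)) : d = v := by
  classical
  -- The value at `t` is irrelevant for the integral and is set to the limit.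
  set f := Function.update (deltaDeriv T F) t v
  have hfE : ∀ s ∈ kappa T \ {t}, deltaDeriv T F s = f s := fun s hs =>
    (Function.update_of_ne hs.2 _ _).symm
  have hf : IsPiecewiseRdContinuous T f := hF.2.2.congr_off_finite (finite_singleton t) hfE
  have hFf : IsDeltaAntideriv T f F := (hF.isDeltaAntideriv h).congr_off_finite
    (finite_singleton t) (fun s hs => by rw [mem_singleton_iff.1 hs, hσ]) hfE
  rw [← sub_eq_zero, ← abs_nonpos_iff]
  refine le_of_forall_pos_le_add fun ε hε => ?_
  obtain ⟨δ, hδ, hδv⟩ := Metric.eventually_nhds_iff.1 (eventually_nhdsWithin_iff.1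
    (hv.eventually (Metric.ball_mem_nhds v (half_pos hε))))
  have hk : 𝓝[kappa T ∩ S] t ≤ 𝓝[T] t := nhdsWithin_mono t fun s hs => hs.1.1
  obtain ⟨s, hs, hsδ, hsd⟩ := (eventually_mem_nhdsWithin.and
    ((eventually_nhdsWithin_of_eventually_nhds (Metric.eventually_nhds_iff_ball.2
      ⟨δ, hδ, fun s hs => hs⟩)).and (hk (hd (ε / 2) (half_pos hε))))).exists
  have hst : s ≠ t := fun hc => htS (hc ▸ hs.2)
  have hpos : 0 < |t - s| := abs_pos.2 (sub_ne_zero.2 hst.symm)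
  rw [hσ] at hsd
  have hint := abs_integral_sub_const_le h hf (c := v) (K := ε / 2) ht hs.1.1 fun r hr => by
    by_cases hrt : r = t
    · rw [hrt, show f t = v from Function.update_self _ _ _, sub_self, abs_zero]
      exact (half_pos hε).le
    · rw [show f r = deltaDeriv T F r from Function.update_of_ne hrt _ _]
      refine (hδv (y := r) ?_ ⟨hr.1, hS s hs.2 ⟨hr.2, hrt⟩⟩).le
      exact lt_of_le_of_lt (abs_sub_left_of_mem_uIcc hr.2) hsδ
  rw [← hFf.sub_eq_integral h hf ht hs.1.1, abs_sub_comm s t] at hint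
  refine le_of_mul_le_mul_right ?_ hpos
  rw [← abs_mul]
  calc |(d - v) * (t - s)|
      = |-(F t - F s - d * (t - s)) - (F s - F t - v * (s - t))| := by ring_nf
    _ ≤ |-(F t - F s - d * (t - s))| + |F s - F t - v * (s - t)| := abs_sub _ _
    _ ≤ (0 + ε) * |t - s| := by rw [abs_neg]; linarith

end Antiderivatives

/-! ### The first variation -/

section Variation

variable {L : ℝ → ℝ → ℝ → ℝ}

/-- The differentiability assumptions on the Lagrangian: `L(t, u, v)` has partial derivatives in
`u` and `v` for `t ∈ T^κ`, and both are jointly continuous on `T^κ × ℝ²`. -/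
structure IsLagrangian (T : Set ℝ) (L : ℝ → ℝ → ℝ → ℝ) : Prop where
  differentiableAt_y : ∀ t ∈ kappa T, ∀ u v : ℝ, DifferentiableAt ℝ (fun x => L t x v) u
  differentiableAt_v : ∀ t ∈ kappa T, ∀ u v : ℝ, DifferentiableAt ℝ (fun x => L t u x) v
  continuousOn_dLdy : ContinuousOn (fun p : ℝ × ℝ × ℝ => dLdy L p.1 p.2.1 p.2.2)
    (kappa T ×ˢ (Set.univ : Set (ℝ × ℝ)))
  continuousOn_dLdv : ContinuousOn (fun p : ℝ × ℝ × ℝ => dLdv L p.1 p.2.1 p.2.2)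
    (kappa T ×ˢ (Set.univ : Set (ℝ × ℝ)))

/-- The chain rule for `L(t, ·, ·)` along a line. -/
lemma IsLagrangian.hasDerivAt_line (hL : IsLagrangian T L) {t : ℝ} (ht : t ∈ kappa T)
    (u v p q ε : ℝ) :
    HasDerivAt (fun e => L t (u + e * p) (v + e * q))
      (dLdy L t (u + ε * p) (v + ε * q) * p + dLdv L t (u + ε * p) (v + ε * q) * q) ε := by
  have hc : Continuous fun w : ℝ × ℝ => (t, w) := by fun_prop
  have hy : Continuous fun w : ℝ × ℝ => dLdy L t w.1 w.2 :=
    continuousOn_univ.1 (hL.continuousOn_dLdy.comp hc.continuousOn fun w _ => ⟨ht, mem_univ _⟩)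
  have hv : Continuous fun w : ℝ × ℝ => dLdv L t w.1 w.2 :=
    continuousOn_univ.1 (hL.continuousOn_dLdv.comp hc.continuousOn fun w _ => ⟨ht, mem_univ _⟩)
  have hLs := hasStrictFDerivAt_uncurry_coprod (𝕜 := ℝ) (u := (u + ε * p, v + ε * q)) (f := L t)
    (f₁ := fun u v => ContinuousLinearMap.toSpanSingleton ℝ (dLdy L t u v))
    (f₂ := fun u v => ContinuousLinearMap.toSpanSingleton ℝ (dLdv L t u v))
    (.of_forall fun w => (hL.differentiableAt_y t ht w.1 w.2).hasDerivAt.hasFDerivAt)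
    (.of_forall fun w => (hL.differentiableAt_v t ht w.1 w.2).hasDerivAt.hasFDerivAt)
    ((ContinuousLinearMap.toSpanSingletonCLE (𝕜 := ℝ) (E := ℝ)).continuous.comp hy).continuousAt
    ((ContinuousLinearMap.toSpanSingletonCLE (𝕜 := ℝ) (E := ℝ)).continuous.comp hv).continuousAt
  have hline : HasDerivAt (fun e : ℝ => (u + e * p, v + e * q)) (p, q) ε := by
    simpa using (((hasDerivAt_id ε).mul_const p).const_add u).prodMk
      (((hasDerivAt_id ε).mul_const q).const_add v)
  refine (hLs.hasFDerivAt.comp_hasDerivAt ε hline).congr_deriv ?_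
  change p * dLdy L t (u + ε * p) (v + ε * q) + q * dLdv L t (u + ε * p) (v + ε * q) = _
  ring

/-- The partial derivatives of `L` are bounded on `T^κ` times a square. -/
lemma IsLagrangian.exists_bound (h : IsTimeScale T a b) (hL : IsLagrangian T L) (R : ℝ) :
    ∃ C, 0 ≤ C ∧ ∀ t ∈ kappa T, ∀ u v : ℝ, |u| ≤ R → |v| ≤ R →
      |dLdy L t u v| ≤ C ∧ |dLdv L t u v| ≤ C := by
  have hc : IsCompact (kappa T ×ˢ (Icc (-R) R ×ˢ Icc (-R) R)) :=
    h.isCompact_kappa.prod (isCompact_Icc.prod isCompact_Icc)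
  have hsub := Set.prod_mono (Subset.refl (kappa T)) (subset_univ (Icc (-R) R ×ˢ Icc (-R) R))
  obtain ⟨C, hC⟩ := hc.exists_bound_of_continuousOn (hL.continuousOn_dLdy.mono hsub)
  obtain ⟨C', hC'⟩ := hc.exists_bound_of_continuousOn (hL.continuousOn_dLdv.mono hsub)
  refine ⟨max (max C C') 0, le_max_right _ _, fun t ht u v hu hv => ?_⟩
  have hm : (t, u, v) ∈ kappa T ×ˢ (Icc (-R) R ×ˢ Icc (-R) R) :=
    ⟨ht, abs_le.1 hu, abs_le.1 hv⟩
  exact ⟨(hC _ hm).trans ((le_max_left _ _).trans (le_max_left _ _)),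
    (hC' _ hm).trans ((le_max_right _ _).trans (le_max_left _ _))⟩

lemma supNorm_le {f : ℝ → ℝ} {K : ℝ} (hf : ∀ t ∈ kappa T, |f t| ≤ K) :
    supNorm T f ≤ ENNReal.ofReal K :=
  iSup₂_le fun t ht => by
    rw [Real.enorm_eq_ofReal_abs]
    exact ENNReal.ofReal_le_ofReal (hf t ht)

/-- A `K`-Lipschitz function bounded by `N` has norm at most `N + K`. -/
lemma norm1_le (h : IsTimeScale T a b) {f : ℝ → ℝ} {N K : ℝ} (hN : ∀ t ∈ T, |f t| ≤ N)
    (hK0 : 0 ≤ K) (hK : ∀ r ∈ T, ∀ s ∈ T, |f r - f s| ≤ K * |r - s|) :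
    norm1 T f ≤ ENNReal.ofReal (N + K) := by
  have hN0 : 0 ≤ N := (abs_nonneg _).trans (hN a h.isLeast.1)
  rw [ENNReal.ofReal_add hN0 hK0]
  refine add_le_add (supNorm_le fun t ht => hN t ht.1) (supNorm_le fun t ht => ?_)
  by_cases hd : DeltaDifferentiableAt T f t
  · exact hd.hasDeltaDerivAt.abs_le h ht hK
  · rwa [deltaDeriv, dif_neg hd, abs_zero]

/-- The first variation of the functional vanishes in the direction of every `η` with piecewise
rd-continuous delta derivative `g` and zero boundary values. -/
lemma first_variation (h : IsTimeScale T a b) (hL : IsLagrangian T L) {ya yb : ℝ}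
    (hprd : ∀ z : ℝ → ℝ, IsAdmissible T a b ya yb z →
      IsPiecewiseRdContinuous T (fun t => L t (z t) (deltaDeriv T z t)) ∧
      IsPiecewiseRdContinuous T (fun t => dLdy L t (z t) (deltaDeriv T z t)) ∧
      IsPiecewiseRdContinuous T (fun t => dLdv L t (z t) (deltaDeriv T z t)))
    {y : ℝ → ℝ} (hy : IsWeakLocalMinimizer T a b ya yb L y) {g : ℝ → ℝ}
    (hg : IsPiecewiseRdContinuous T g) (hg0 : primitive T a g b = 0) :
    ∫ x in a..b, (dLdy L (proj T x) (y (proj T x)) (deltaDeriv T y (proj T x)) *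
        primitive T a g (proj T x) +
      dLdv L (proj T x) (y (proj T x)) (deltaDeriv T y (proj T x)) * g (proj T x)) = 0 := by
  obtain ⟨hadm, δ, hδ, hmin⟩ := hy
  have hyC := hadm.1
  have ha := left_mem_Icc.2 h.lt.le
  have hb := right_mem_Icc.2 h.lt.le
  set η := primitive T a g with hη
  have hη_anti : IsDeltaAntideriv T g η := isDeltaAntideriv_primitive h hg
  have hηa : η a = 0 := intervalIntegral.integral_same
  -- The comparison functions are `y + εη`.
  set z : ℝ → ℝ → ℝ := fun ε t => y t + ε * η t with hz
  have hz_anti : ∀ ε, IsDeltaAntideriv T (fun t => deltaDeriv T y t + ε * g t) (z ε) := fun ε =>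
    (hyC.isDeltaAntideriv h).add_const_mul hη_anti ε
  have hz_adm : ∀ ε, IsAdmissible T a b ya yb (z ε) := by
    refine fun ε => ⟨(hz_anti ε).isC1prd h ?_, ?_, ?_⟩
    · exact hyC.2.2.comp₂ hg (Φ := fun w => w.1 + ε * w.2) (by fun_prop)
    · simp [hz, hηa, hadm.2.1]
    · simp [hz, hg0, hadm.2.2]
  set Φ : ℝ → ℝ → ℝ := fun ε x => L (proj T x) (y (proj T x) + ε * η (proj T x))
    (deltaDeriv T y (proj T x) + ε * g (proj T x)) with hΦ
  have hae : ∀ᵐ x, x ∈ uIoc a b → x ∈ Ioo a b := by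
    filter_upwards [MeasureTheory.volume.ae_ne b] with x hx hxab
    rw [uIoc_of_le h.lt.le] at hxab
    exact ⟨hxab.1, hxab.2.lt_of_ne hx⟩
  have hΦz : ∀ ε, ∀ᵐ x, x ∈ uIoc a b →
      L (proj T x) (z ε (proj T x)) (deltaDeriv T (z ε) (proj T x)) = Φ ε x := by
    intro ε
    filter_upwards [hae, (hz_anti ε).ae_deltaDeriv_eq h] with x hx hxd hxab
    rw [hxd (hx hxab)]
  have hΦint : ∀ ε, IntervalIntegrable (Φ ε) MeasureTheory.volume a b := by
    intro ε
    refine ((hprd _ (hz_adm ε)).1.intervalIntegrable_proj h ha hb).congr_ae ?_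
    rw [Filter.EventuallyEq, MeasureTheory.ae_restrict_iff' measurableSet_uIoc]
    exact hΦz ε
  have hfun : ∀ ε, functional T a b L (z ε) = ∫ x in a..b, Φ ε x := fun ε => by
    rw [functional, deltaIntegral_eq h (hprd _ (hz_adm ε)).1 h.isLeast.1 h.isGreatest.1]
    exact intervalIntegral.integral_congr_ae (hΦz ε)
  obtain ⟨K, hK0, hK⟩ := hg.exists_bound h
  have hLip : ∀ r ∈ T, ∀ s ∈ T, |η r - η s| ≤ K * |r - s| := fun r hr s hs =>
    abs_primitive_sub_le h hg hK hr hs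
  have hηN : ∀ t ∈ T, |η t| ≤ K * (b - a) := by
    intro t ht
    have h1 := hLip t ht a h.isLeast.1
    rw [hηa, sub_zero, abs_of_nonneg (sub_nonneg.2 (h.isLeast.2 ht))] at h1
    exact h1.trans (mul_le_mul_of_nonneg_left (by linarith [h.isGreatest.2 ht]) hK0.le)
  have hlocmin : IsLocalMin (fun ε => ∫ x in a..b, Φ ε x) 0 := by
    have hsmall : ∀ᶠ ε : ℝ in 𝓝 0, |ε| * (K * (b - a) + K) < δ := by
      have hc : Continuous fun ε : ℝ => |ε| * (K * (b - a) + K) := by fun_prop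
      exact (hc.tendsto 0).eventually_lt_const (by simpa using hδ)
    filter_upwards [hsmall] with ε hε
    rw [← hfun, ← hfun]
    have hz0 : z 0 = y := by
      ext t
      simp [hz]
    rw [hz0]
    refine hmin _ (hz_adm ε) (lt_of_le_of_lt ?_ ((ENNReal.ofReal_lt_ofReal_iff hδ).2 hε))
    rw [mul_add]
    refine norm1_le h (fun t ht => ?_) (by positivity) fun r hr s hs => ?_
    · have : y t - z ε t = -(ε * η t) := by simp only [hz]; ring
      rw [this, abs_neg, abs_mul]
      exact mul_le_mul_of_nonneg_left (hηN t ht) (abs_nonneg ε)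
    · have : y r - z ε r - (y s - z ε s) = -(ε * (η r - η s)) := by simp only [hz]; ring
      rw [this, abs_neg, abs_mul, mul_assoc]
      exact mul_le_mul_of_nonneg_left (hLip r hr s hs) (abs_nonneg ε)
  obtain ⟨Y, hY0, hY⟩ := (IsPiecewiseRdContinuous.of_continuousOn hyC.1).exists_bound h
  obtain ⟨D, hD0, hD⟩ := hyC.2.2.exists_bound h
  have hba : 0 ≤ K * (b - a) := mul_nonneg hK0.le (sub_nonneg.2 h.lt.le)
  obtain ⟨C, hC0, hC⟩ := hL.exists_bound h (Y + D + K * (b - a) + K)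
  set Φ' : ℝ → ℝ → ℝ := fun ε x =>
    dLdy L (proj T x) (y (proj T x) + ε * η (proj T x))
      (deltaDeriv T y (proj T x) + ε * g (proj T x)) * η (proj T x) +
    dLdv L (proj T x) (y (proj T x) + ε * η (proj T x))
      (deltaDeriv T y (proj T x) + ε * g (proj T x)) * g (proj T x) with hΦ'
  have hΦ'0 : Φ' 0 = fun x =>
      dLdy L (proj T x) (y (proj T x)) (deltaDeriv T y (proj T x)) * η (proj T x) +
      dLdv L (proj T x) (y (proj T x)) (deltaDeriv T y (proj T x)) * g (proj T x) := by
    ext x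
    simp only [hΦ', zero_mul, add_zero]
  have hΦ'm : IntervalIntegrable (Φ' 0) MeasureTheory.volume a b := by
    rw [hΦ'0]
    have h1 := (hprd y hadm).2.1.comp₂ (.of_continuousOn hη_anti.1) continuous_mul
    have h2 := (hprd y hadm).2.2.comp₂ hg continuous_mul
    exact (h1.comp₂ h2 continuous_add).intervalIntegrable_proj h ha hb
  have hderiv := (intervalIntegral.hasDerivAt_integral_of_dominated_loc_of_deriv_le
    (F := Φ) (F' := Φ') (x₀ := (0 : ℝ)) (bound := fun _ => C * (K * (b - a)) + C * K)
    (Metric.ball_mem_nhds 0 one_pos)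
    (.of_forall fun ε => (intervalIntegrable_iff.1 (hΦint ε)).aestronglyMeasurable) (hΦint 0)
    (intervalIntegrable_iff.1 hΦ'm).aestronglyMeasurable ?_ intervalIntegrable_const ?_).2
  · have := hlocmin.hasDerivAt_eq_zero hderiv
    rwa [hΦ'0] at this
  · filter_upwards [hae] with x hx hxab ε hε
    have hk : proj T x ∈ kappa T := h.proj_mem_kappa (hx hxab).1.le (hx hxab).2
    have hε1 : |ε| ≤ 1 := by simpa using (Metric.mem_ball.1 hε).le
    have h1 : |ε * η (proj T x)| ≤ K * (b - a) := by
      rw [abs_mul]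
      exact (mul_le_of_le_one_left (abs_nonneg _) hε1).trans (hηN _ hk.1)
    have h2 : |ε * g (proj T x)| ≤ K := by
      rw [abs_mul]
      exact (mul_le_of_le_one_left (abs_nonneg _) hε1).trans (hK _ hk)
    obtain ⟨hC1, hC2⟩ := hC _ hk (y (proj T x) + ε * η (proj T x))
      (deltaDeriv T y (proj T x) + ε * g (proj T x))
      ((abs_add_le _ _).trans (by linarith [hY _ hk]))
      ((abs_add_le _ _).trans (by linarith [hD _ hk]))
    refine (abs_add_le _ _).trans (add_le_add ?_ ?_) <;> rw [abs_mul]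
    · exact mul_le_mul hC1 (hηN _ hk.1) (abs_nonneg _) hC0
    · exact mul_le_mul hC2 (hK _ hk) (abs_nonneg _) hC0
  · filter_upwards [hae] with x hx hxab ε _
    exact hL.hasDerivAt_line (h.proj_mem_kappa (hx hxab).1.le (hx hxab).2) _ _ _ _ ε

end Variation

/-! ### The du Bois-Reymond argument -/

section DuBoisReymond

variable {L : ℝ → ℝ → ℝ → ℝ}

/-- Integration by parts: for `η` vanishing at both ends,
`∫ p η Δt = -∫ P^σ η^Δ Δt`, where `P` is a primitive of `p`. -/
lemma integral_mul_primitive (h : IsTimeScale T a b) {p g : ℝ → ℝ}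
    (hp : IsPiecewiseRdContinuous T p) (hg : IsPiecewiseRdContinuous T g)
    (hg0 : primitive T a g b = 0) :
    ∫ x in a..b, p (proj T x) * primitive T a g (proj T x) =
      -∫ x in a..b, primitive T a p (sigma T (proj T x)) * g (proj T x) := by
  have ha := left_mem_Icc.2 h.lt.le
  have hb := right_mem_Icc.2 h.lt.le
  have hP := isDeltaAntideriv_primitive h hp
  have hG := isDeltaAntideriv_primitive h hg
  have h1 : IsPiecewiseRdContinuous T (fun t => p t * primitive T a g t) :=
    hp.comp₂ (.of_continuousOn hG.1) continuous_mul
  have h2 : IsPiecewiseRdContinuous T (fun t => primitive T a p (sigma T t) * g t) :=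
    (IsPiecewiseRdContinuous.comp_sigma h hP.1).comp₂ hg continuous_mul
  have h3 := (hP.mul hG).sub_eq_integral h (h1.comp₂ h2 continuous_add) h.isLeast.1 h.isGreatest.1
  have ha0 : primitive T a g a = 0 := intervalIntegral.integral_same
  rw [ha0, hg0, intervalIntegral.integral_add (h1.intervalIntegrable_proj h ha hb)
    (h2.intervalIntegrable_proj h ha hb)] at h3
  linarith

/-- If `∫ (p η + q η^Δ) Δt = 0` for all `η` vanishing at both ends, then `q - P^σ` is almost
everywhere constant, `P` being a primitive of `p`. The test function is the one with
`η^Δ = q - P^σ - c`, where `c` is the mean value of `q - P^σ`, so that `η` vanishes at both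
ends. -/
lemma exists_ae_eq_of_variation_eq_zero (h : IsTimeScale T a b) {p q : ℝ → ℝ}
    (hp : IsPiecewiseRdContinuous T p) (hq : IsPiecewiseRdContinuous T q)
    (hvar : ∀ g, IsPiecewiseRdContinuous T g → primitive T a g b = 0 →
      ∫ x in a..b, (p (proj T x) * primitive T a g (proj T x) + q (proj T x) * g (proj T x)) = 0) :
    ∃ c, ∀ᵐ x, x ∈ Ioo a b →
      q (proj T x) = primitive T a p (sigma T (proj T x)) + c := by
  have ha := left_mem_Icc.2 h.lt.le
  have hb := right_mem_Icc.2 h.lt.le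
  have hP := isDeltaAntideriv_primitive h hp
  have hPσ : IsPiecewiseRdContinuous T (fun t => primitive T a p (sigma T t)) :=
    .comp_sigma h hP.1
  have hk : IsPiecewiseRdContinuous T (fun t => q t - primitive T a p (sigma T t)) :=
    hq.comp₂ hPσ continuous_sub
  set c := (∫ x in a..b, (q (proj T x) - primitive T a p (sigma T (proj T x)))) / (b - a) with hc
  set g : ℝ → ℝ := fun t => q t - primitive T a p (sigma T t) - c with hg_def
  have hg : IsPiecewiseRdContinuous T g :=
    hk.comp₂ hk (Φ := fun w => w.1 - c) (by fun_prop)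
  have hg0 : primitive T a g b = 0 := by
    change ∫ x in a..b, (q (proj T x) - primitive T a p (sigma T (proj T x)) - c) = 0
    rw [intervalIntegral.integral_sub (hk.intervalIntegrable_proj h ha hb)
      intervalIntegrable_const, intervalIntegral.integral_const, smul_eq_mul, hc,
      mul_div_cancel₀ _ (sub_pos.2 h.lt).ne', sub_self]
  have hG := isDeltaAntideriv_primitive h hg
  have hi1 : IsPiecewiseRdContinuous T (fun t => p t * primitive T a g t) :=
    hp.comp₂ (.of_continuousOn hG.1) continuous_mul
  have hi2 := hq.comp₂ hg continuous_mul
  have hi3 := hPσ.comp₂ hg continuous_mul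
  have hi4 := hg.comp₂ hg continuous_mul
  have hsq : ∫ x in a..b, g (proj T x) * g (proj T x) = 0 := by
    have h1 := hvar g hg hg0
    rw [intervalIntegral.integral_add (hi1.intervalIntegrable_proj h ha hb)
      (hi2.intervalIntegrable_proj h ha hb), integral_mul_primitive h hp hg hg0] at h1
    have h2 : ∫ x in a..b, g (proj T x) * g (proj T x) =
        (∫ x in a..b, q (proj T x) * g (proj T x)) -
        (∫ x in a..b, primitive T a p (sigma T (proj T x)) * g (proj T x)) -
        c * ∫ x in a..b, g (proj T x) := by
      rw [← intervalIntegral.integral_const_mul, ← intervalIntegral.integral_sub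
        (hi2.intervalIntegrable_proj h ha hb) (hi3.intervalIntegrable_proj h ha hb),
        ← intervalIntegral.integral_sub]
      · refine intervalIntegral.integral_congr fun x _ => ?_
        simp only [hg_def]
        ring
      · exact (hi2.intervalIntegrable_proj h ha hb).sub (hi3.intervalIntegrable_proj h ha hb)
      · exact (hg.intervalIntegrable_proj h ha hb).const_mul c
    have h3 : ∫ x in a..b, g (proj T x) = 0 := hg0
    rw [h2, h3]
    linarith
  refine ⟨c, ?_⟩
  rw [intervalIntegral.integral_eq_zero_iff_of_le_of_nonneg_ae h.lt.le
    (.of_forall fun x => mul_self_nonneg _) (hi4.intervalIntegrable_proj h ha hb),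
    Filter.EventuallyEq, MeasureTheory.ae_restrict_iff' measurableSet_Ioc] at hsq
  filter_upwards [hsq] with x hx hxab
  have := mul_self_eq_zero.1 (hx (Ioo_subset_Ioc_self hxab))
  simp only [hg_def] at this
  linarith

/-- A property of almost all projections holds at every right-scattered point, since the gap to
its right has positive length. -/
lemma of_ae_proj_of_right_scattered (h : IsTimeScale T a b) {Q : ℝ → Prop}
    (hQ : ∀ᵐ x, x ∈ Ioo a b → Q (proj T x)) {t : ℝ} (ht : t ∈ T) (hσ : t < sigma T t) : Q t := by
  obtain ⟨x, hx, hxQ⟩ := (MeasureTheory.Measure.dense_of_ae hQ).exists_mem_open isOpen_Ioo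
    (nonempty_Ioo.2 hσ)
  rw [← h.proj_eq_of_mem_Ico ht ⟨hxQ.1.le, hxQ.2⟩]
  exact hx ⟨(h.isLeast.2 ht).trans_lt hxQ.1, hxQ.2.trans_le (h.isGreatest.2 (h.sigma_mem t))⟩

lemma frequently_right_of_ae_proj (h : IsTimeScale T a b) {Q : ℝ → Prop}
    (hQ : ∀ᵐ x, x ∈ Ioo a b → Q (proj T x)) {t : ℝ}
    (htd : ∀ r > t, ∃ s ∈ T, s ∈ Ioo t r) : ∃ᶠ s in 𝓝[kappa T ∩ Ioi t] t, Q s := by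
  intro hev
  obtain ⟨δ, hδ, hδQ⟩ := Metric.eventually_nhds_iff.1 (eventually_nhdsWithin_iff.1 hev)
  obtain ⟨s, hs, hts, hsδ⟩ := htd (t + δ) (by linarith)
  obtain ⟨r, hr, htr, hrs⟩ := htd s hts
  obtain ⟨x, hx, hxr, hxs⟩ := (MeasureTheory.Measure.dense_of_ae hQ).exists_mem_open isOpen_Ioo
    (nonempty_Ioo.2 hrs)
  have hax : a < x := (h.isLeast.2 hr).trans_lt hxr
  have hxb : x < b := hxs.trans_le (h.isGreatest.2 hs)
  have h1 := le_proj hr hxr.le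
  have h2 := h.proj_le hax.le
  refine hδQ (y := proj T x) ?_ ⟨h.proj_mem_kappa hax.le hxb, htr.trans_le h1⟩ (hx ⟨hax, hxb⟩)
  rw [Real.dist_eq, abs_lt]
  constructor <;> linarith

lemma frequently_left_of_ae_proj (h : IsTimeScale T a b) {Q : ℝ → Prop}
    (hQ : ∀ᵐ x, x ∈ Ioo a b → Q (proj T x)) {t : ℝ} (ht : t ∈ T)
    (htd : ∀ r < t, ∃ s ∈ T, s ∈ Ioo r t) : ∃ᶠ s in 𝓝[kappa T ∩ Iio t] t, Q s := by
  intro hev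
  obtain ⟨δ, hδ, hδQ⟩ := Metric.eventually_nhds_iff.1 (eventually_nhdsWithin_iff.1 hev)
  obtain ⟨s, hs, hsδ, hst⟩ := htd (t - δ) (by linarith)
  obtain ⟨x, hx, hxs, hxt⟩ := (MeasureTheory.Measure.dense_of_ae hQ).exists_mem_open isOpen_Ioo
    (nonempty_Ioo.2 hst)
  have hax : a < x := (h.isLeast.2 hs).trans_lt hxs
  have hxb : x < b := hxt.trans_le (h.isGreatest.2 ht)
  have h1 := le_proj hs hxs.le
  have h2 := h.proj_le hax.le
  refine hδQ (y := proj T x) ?_ ⟨h.proj_mem_kappa hax.le hxb, h2.trans_lt hxt⟩ (hx ⟨hax, hxb⟩)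
  rw [Real.dist_eq, abs_lt]
  constructor <;> linarith

/-- The integrated Euler–Lagrange equation passes to the limit from a side `S` on which it holds
arbitrarily close to `t`. The right-hand side has limit `P t + c`, which is `P (σ(t)) + c` when `t`
is right-dense. -/
lemma euler_limit (hL : IsLagrangian T L) {y P : ℝ → ℝ} (hy : ContinuousOn y T)
    (hP : ContinuousOn P T) {c t v : ℝ} (ht : t ∈ kappa T) {S : Set ℝ}
    (hσ : Tendsto (sigma T) (𝓝[kappa T ∩ S] t) (𝓝[T] t))
    (hfreq : ∃ᶠ s in 𝓝[kappa T ∩ S] t, dLdv L s (y s) (deltaDeriv T y s) = P (sigma T s) + c)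
    (hv : Tendsto (deltaDeriv T y) (𝓝[kappa T ∩ S] t) (𝓝 v)) :
    dLdv L t (y t) v = P t + c := by
  have hkT : kappa T ∩ S ⊆ T := fun s hs => hs.1.1
  have hyt : Tendsto y (𝓝[kappa T ∩ S] t) (𝓝 (y t)) :=
    (hy t ht.1).mono_left (nhdsWithin_mono t hkT)
  have hid : Tendsto (fun s : ℝ => s) (𝓝[kappa T ∩ S] t) (𝓝 t) := nhdsWithin_le_nhds
  have htend : Tendsto (fun s => (s, y s, deltaDeriv T y s)) (𝓝[kappa T ∩ S] t)
      (𝓝[kappa T ×ˢ (univ : Set (ℝ × ℝ))] (t, y t, v)) := by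
    refine tendsto_nhdsWithin_iff.2 ⟨hid.prodMk_nhds (hyt.prodMk_nhds hv), ?_⟩
    filter_upwards [self_mem_nhdsWithin] with s hs
    exact ⟨hs.1, mem_univ _⟩
  have h1 := (hL.continuousOn_dLdv (t, y t, v) ⟨ht, mem_univ _⟩).tendsto.comp htend
  have h2 := ((hP t ht.1).tendsto.comp hσ).add_const c
  exact tendsto_nhds_unique_of_frequently_eq h1 h2 hfreq

end DuBoisReymond

end TimeScale

end

open TimeScale in
theorem mainTheorem2 (T : Set ℝ) (a b : ℝ) (hT : IsClosed T)
    (ha : IsLeast T a) (hb : IsGreatest T b) (hab : a < b)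
    (ya yb : ℝ) (L : ℝ → ℝ → ℝ → ℝ)
    (hLy : ∀ t ∈ TimeScale.kappa T, ∀ u v : ℝ, DifferentiableAt ℝ (fun x => L t x v) u)
    (hLv : ∀ t ∈ TimeScale.kappa T, ∀ u v : ℝ, DifferentiableAt ℝ (fun x => L t u x) v)
    (hLyc : ContinuousOn (fun p : ℝ × ℝ × ℝ => TimeScale.dLdy L p.1 p.2.1 p.2.2)
      (TimeScale.kappa T ×ˢ (Set.univ : Set (ℝ × ℝ))))
    (hLvc : ContinuousOn (fun p : ℝ × ℝ × ℝ => TimeScale.dLdv L p.1 p.2.1 p.2.2)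
      (TimeScale.kappa T ×ˢ (Set.univ : Set (ℝ × ℝ))))
    (hprd : ∀ z : ℝ → ℝ, TimeScale.IsAdmissible T a b ya yb z →
      TimeScale.IsPiecewiseRdContinuous T
          (fun t => L t (z t) (TimeScale.deltaDeriv T z t)) ∧
        TimeScale.IsPiecewiseRdContinuous T
          (fun t => TimeScale.dLdy L t (z t) (TimeScale.deltaDeriv T z t)) ∧
        TimeScale.IsPiecewiseRdContinuous T
          (fun t => TimeScale.dLdv L t (z t) (TimeScale.deltaDeriv T z t)))
    (y : ℝ → ℝ) (hy : TimeScale.IsWeakLocalMinimizer T a b ya yb L y) :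
    ∃ c₁ : ℝ, ∀ t ∈ TimeScale.kappa T,
      (TimeScale.DeltaDifferentiableAt T y t →
        TimeScale.dLdv L t (y t) (TimeScale.deltaDeriv T y t) =
          TimeScale.deltaIntegral T
            (fun τ => TimeScale.dLdy L τ (y τ) (TimeScale.deltaDeriv T y τ))
            a (TimeScale.sigma T t) + c₁) ∧
      (¬ TimeScale.DeltaDifferentiableAt T y t →
        ∃ vl vr : ℝ,
          Tendsto (TimeScale.deltaDeriv T y) (𝓝[TimeScale.kappa T ∩ Iio t] t) (𝓝 vl) ∧
          Tendsto (TimeScale.deltaDeriv T y) (𝓝[TimeScale.kappa T ∩ Ioi t] t) (𝓝 vr) ∧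
          ∀ v : ℝ, v = vl ∨ v = vr →
            TimeScale.dLdv L t (y t) v =
              TimeScale.deltaIntegral T
                (fun τ => TimeScale.dLdy L τ (y τ) (TimeScale.deltaDeriv T y τ))
                a (TimeScale.sigma T t) + c₁) := by
  have h : IsTimeScale T a b := ⟨hT, ha, hb, hab⟩
  have hL : IsLagrangian T L := ⟨hLy, hLv, hLyc, hLvc⟩
  have hyC : IsC1prd T y := hy.1.1
  obtain ⟨-, hp, hq⟩ := hprd y hy.1
  set p : ℝ → ℝ := fun τ => dLdy L τ (y τ) (deltaDeriv T y τ)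
  obtain ⟨c, hc⟩ := exists_ae_eq_of_variation_eq_zero h hp hq
    fun g hg hg0 => first_variation h hL hprd hy hg hg0
  -- By `hc`, the equation holds at the projection of almost every point of `(a, b)`.
  set Q : ℝ → Prop := fun t =>
    dLdv L t (y t) (deltaDeriv T y t) = primitive T a p (sigma T t) + c
  have hc' : ∀ᵐ x, x ∈ Ioo a b → Q (proj T x) := hc
  have hP := (isDeltaAntideriv_primitive h hp).1
  have hint : ∀ t, deltaIntegral T p a (sigma T t) = primitive T a p (sigma T t) :=
    fun t => deltaIntegral_eq h hp ha.1 (h.sigma_mem t)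
  have hright : ∀ t ∈ kappa T, t < b → sigma T t = t →
      (𝓝[kappa T ∩ Ioi t] t).NeBot ∧ ∀ v,
        Tendsto (deltaDeriv T y) (𝓝[kappa T ∩ Ioi t] t) (𝓝 v) →
          dLdv L t (y t) v = primitive T a p t + c := by
    intro t ht htb hσ
    have hfr := frequently_right_of_ae_proj h hc'
      fun r hr => h.exists_mem_Ioo_right htb hσ hr
    exact ⟨⟨fun hbot => by simp [hbot] at hfr⟩, fun v hv =>
      euler_limit hL hyC.1 hP ht (h.tendsto_sigma ht.1).1 hfr hv⟩
  have hleft : ∀ t ∈ kappa T, (𝓝[kappa T ∩ Iio t] t).NeBot → ∀ v,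
      Tendsto (deltaDeriv T y) (𝓝[kappa T ∩ Iio t] t) (𝓝 v) →
        dLdv L t (y t) v = primitive T a p t + c := by
    intro t ht hne v hv
    refine euler_limit hL hyC.1 hP ht (h.tendsto_sigma ht.1).2
      (frequently_left_of_ae_proj h hc' ht.1 fun r hr => ?_) hv
    obtain ⟨s, hs, hrs⟩ := ((eventually_mem_nhdsWithin (a := t)
      (s := kappa T ∩ Iio t)).and
      (eventually_nhdsWithin_of_eventually_nhds (eventually_gt_nhds hr))).exists
    exact ⟨s, hs.1.1, hrs, hs.2⟩
  -- The maximum of `T` can only be approached from the left.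
  have hmax : b ∈ kappa T → (𝓝[kappa T ∩ Iio b] b).NeBot := by
    refine fun hbk => ⟨fun hbot => ?_⟩
    have hfr := frequently_left_of_ae_proj h hc' hb.1
      fun r hr => h.exists_mem_Ioo_left_max hbk hr
    simp [hbot] at hfr
  refine ⟨c, fun t ht => ⟨fun hd => ?_, fun hd => ?_⟩⟩
  · rw [hint]
    rcases (h.le_sigma (hb.2 ht.1)).lt_or_eq with hσ | hσ
    · exact of_ae_proj_of_right_scattered h hc' ht.1 hσ
    obtain ⟨⟨vr, hvr⟩, vl, hvl⟩ := hyC.2.2.1 t ht.1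
    rw [← hσ]
    rcases (hb.2 ht.1).lt_or_eq with htb | rfl
    · obtain ⟨hne, hE⟩ := hright t ht htb hσ.symm
      have hS : ∀ s ∈ Ioi t, uIcc t s \ {t} ⊆ Ioi t := fun s hs r hr => by
        rw [uIcc_of_le (le_of_lt hs)] at hr
        exact lt_of_le_of_ne hr.1.1 (Ne.symm hr.2)
      rw [hyC.deltaDeriv_eq_limit h ht.1 hσ.symm hd.hasDeltaDerivAt (S := Ioi t) (lt_irrefl t)
        hS hvr]
      exact hE vr hvr
    · have hne := hmax ht
      have hS : ∀ s ∈ Iio t, uIcc t s \ {t} ⊆ Iio t := fun s hs r hr => by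
        rw [uIcc_of_ge (le_of_lt hs)] at hr
        exact lt_of_le_of_ne hr.1.2 hr.2
      rw [hyC.deltaDeriv_eq_limit h ht.1 hσ.symm hd.hasDeltaDerivAt (S := Iio t) (lt_irrefl t)
        hS hvl]
      exact hleft t ht hne vl hvl
  · have hσ := sigma_eq_of_not_deltaDifferentiableAt h hyC.1 ht.1 hd
    rw [hint, hσ]
    obtain ⟨⟨vr, hvr⟩, vl, hvl⟩ := hyC.2.2.1 t ht.1
    -- On a side from which `t` is not approached every number is a limit; the limit from the
    -- other side is taken there.
    rcases (hb.2 ht.1).lt_or_eq with htb | rfl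
    · obtain ⟨-, hE⟩ := hright t ht htb hσ
      rcases eq_or_neBot (𝓝[kappa T ∩ Iio t] t) with hbot | hne
      · exact ⟨vr, vr, hbot ▸ tendsto_bot, hvr, fun v hv => by
          rw [or_self] at hv
          exact hv ▸ hE vr hvr⟩
      · refine ⟨vl, vr, hvl, hvr, ?_⟩
        rintro v (rfl | rfl)
        exacts [hleft t ht hne v hvl, hE v hvr]
    · have hbot : kappa T ∩ Ioi t = ∅ :=
        eq_empty_of_forall_notMem fun s hs => (hb.2 hs.1.1).not_gt hs.2
      refine ⟨vl, vl, hvl, by rw [hbot, nhdsWithin_empty]; exact tendsto_bot, fun v hv => ?_⟩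
      rw [or_self] at hv
      exact hv ▸ hleft t ht (hmax ht) vl hvl
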